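/- Let $d,N\in\mathbb N$ and $T>0$, and let $\mathcal P_2(X)$ denote the Borel probability measures with finite second moment on a Euclidean space $X$, with the 2-Wasserstein distance $W_2$. Let $\lambda:\mathcal P_2(\mathbb R^d)\to(0,\infty)$ be bounded and $W_2$-continuous. For $\mu\in\mathcal P_2((\mathbb R^d)^N)$ let $\mu^i=(p_i)_\#\mu$ be its $i$-th marginal, let $$\mathrm{Bar}(\mu)=\operatorname*{argmin}_{\nu\in\mathcal P_2(\mathbb R^d)}\ \sum_{i=1}^N\lambda(\mu^i)\,W_2^2(\mu^i,\nu)$$ be the set of weighted Wasserstein barycenters, and let $$\mathcal V[\mu]=\Big\{\bigotimes_{i=1}^N(\pi_0,\pi_1-\pi_0)_\#\gamma^i\ :\ \gamma^i\text{ is a } W_2\text{-optimal plan between }\mu^i\text{ and some }\nu^i\in\mathrm{Bar}(\mu),\ i=1,\dots,N\Big\},$$ where $\pi_0(x,y)=x$, $\pi_1(x,y)=y$, and the product is regarded as a probability measure on $T(\mathbb R^d)^N=(\mathbb R^d)^N\times(\mathbb R^d)^N$ (base points and velocities). Let $\mathrm{Sol}[\mathcal V]$ be the set of solutions on $[0,T]$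 of the consensus measure differential inclusion $\dot\mu_t\in\mathcal V[\mu_t]$, that is, of all curves $\mu\in C([0,T],(\mathcal P_2((\mathbb R^d)^N),W_2))$ such that for every $\varphi\in C_c^\infty((\mathbb R^d)^N)$ the function $t\mapsto\int\varphi\,d\mu_t$ is absolutely continuous on $[0,T]$ and, for almost every $t\in[0,T]$, $$\frac{d}{dt}\int\varphi\,d\mu_t\in\Big\{\int v\cdot\nabla\varphi(x)\,W(dx,dv)\ :\ W\in\mathcal V[\mu_t]\Big\}.$$ Then $\mathrm{Sol}[\mathcal V]$ is closed under uniform $W_2$-convergence: if $\mu^n\in\mathrm{Sol}[\mathcal V]$ for all $n$ and $\mu:[0,T]\to\mathcal P_2((\mathbb R^d)^N)$ satisfies $\sup_{t\in[0,T]}W_2(\mu^n_t,\mu_t)\to0$, then $\mu\in\mathrm{Sol}[\mathcal V]$. Moreover, if all the curves $\mu^n$ are Lipschitz on $[0,T]$ with respect to $W_2$ with a common constant $L$, then so is $\mu$. -/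

import Mathlib

open MeasureTheory Filter Topology Set
open scoped ENNReal ContDiff

namespace ConsensusMDI

/-- Probability measures with finite second moment on a normed space `X`. The class carries no
topology of its own: all convergence below is with respect to the Wasserstein distance `W2`. -/
structure P2 (X : Type*) [NormedAddCommGroup X] [MeasurableSpace X] where
  /-- the underlying measure -/
  toMeasure : Measure X
  isProb : IsProbabilityMeasure toMeasure
  moment : ∫⁻ x, ‖x‖ₑ ^ 2 ∂toMeasure < ⊤

attribute [instance] P2.isProb

section Wasserstein

variable {X : Type*} [NormedAddCommGroup X] [MeasurableSpace X]

/-- The transport plans between `μ` and `ν`: measures on `X × X` with marginals `μ` and `ν`.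
They are probability measures because `μ` is one. -/
def couplings (μ ν : P2 X) : Set (Measure (X × X)) :=
  {γ | γ.fst = μ.toMeasure ∧ γ.snd = ν.toMeasure}

/-- The quadratic cost of a transport plan. -/
noncomputable def cost (γ : Measure (X × X)) : ℝ≥0∞ :=
  ∫⁻ p, ‖p.1 - p.2‖ₑ ^ 2 ∂γ

/-- The squared 2-Wasserstein distance. -/
noncomputable def W2sq (μ ν : P2 X) : ℝ≥0∞ :=
  ⨅ γ ∈ couplings μ ν, cost γ

/-- The 2-Wasserstein distance (it is finite on `P2 X`). -/
noncomputable def W2 (μ ν : P2 X) : ℝ≥0∞ :=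
  W2sq μ ν ^ (1 / 2 : ℝ)

/-- The optimal transport plans between `μ` and `ν`. -/
def optCouplings (μ ν : P2 X) : Set (Measure (X × X)) :=
  {γ | γ ∈ couplings μ ν ∧ cost γ = W2sq μ ν}

/-- Continuity of a real function on the metric space `(P2 X, W2)`. -/
def W2Continuous (f : P2 X → ℝ) : Prop :=
  ∀ (u : ℕ → P2 X) (m : P2 X), Tendsto (fun n => W2 (u n) m) atTop (𝓝 0) →
    Tendsto (fun n => f (u n)) atTop (𝓝 (f m))

/-- Continuity on `[0, T]` of a curve in the metric space `(P2 X, W2)`. -/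
def W2ContinuousOn (T : ℝ) (μ : ℝ → P2 X) : Prop :=
  ∀ s ∈ Icc 0 T, Tendsto (fun t => W2 (μ t) (μ s)) (𝓝[Icc 0 T] s) (𝓝 0)

/-- Lipschitz continuity on `[0, T]`, with constant `L`, of a curve in `(P2 X, W2)`. -/
def W2LipschitzOn (L : NNReal) (T : ℝ) (μ : ℝ → P2 X) : Prop :=
  ∀ s ∈ Icc 0 T, ∀ t ∈ Icc 0 T, W2 (μ s) (μ t) ≤ L * edist s t

end Wasserstein

/-- `ℝᵈ` with the Euclidean norm. -/
abbrev Space (d : ℕ) : Type := EuclideanSpace ℝ (Fin d)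

/-- `(ℝᵈ)ᴺ` with the Euclidean norm. -/
abbrev Ensemble (d N : ℕ) : Type := PiLp 2 (fun _ : Fin N => Space d)

variable {d N : ℕ}

/-- The `i`-th agent `μⁱ = (pᵢ)_# μ` of an ensemble measure `μ` on `(ℝᵈ)ᴺ`. -/
noncomputable def agent (μ : P2 (Ensemble d N)) (i : Fin N) : P2 (Space d) where
  toMeasure := μ.toMeasure.map (fun x => x i)
  isProb := Measure.isProbabilityMeasure_map (by fun_prop)
  moment := by
    rw [lintegral_map (by fun_prop) (by fun_prop)]
    refine lt_of_le_of_lt (lintegral_mono fun x => ?_) μ.moment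
    have h : ‖x i‖ₑ ≤ ‖x‖ₑ := by
      rw [enorm_le_iff_norm_le]
      exact PiLp.norm_apply_le x i
    gcongr

/-- The barycenter functional `ν ↦ ∑ᵢ λ(μⁱ) W₂²(μⁱ, ν)`. -/
noncomputable def barFunctional (lam : P2 (Space d) → ℝ) (μ : P2 (Ensemble d N))
    (ν : P2 (Space d)) : ℝ≥0∞ :=
  ∑ i, ENNReal.ofReal (lam (agent μ i)) * W2sq (agent μ i) ν

/-- The set of weighted Wasserstein barycenters of the agents of `μ`. -/
def Bar (lam : P2 (Space d) → ℝ) (μ : P2 (Ensemble d N)) : Set (P2 (Space d)) :=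
  {ν | ∀ ν', barFunctional lam μ ν ≤ barFunctional lam μ ν'}

/-- The product `⨂ᵢ Vⁱ` of measures on the tangent bundle `Tℝᵈ = ℝᵈ × ℝᵈ`, seen as a measure on
`T(ℝᵈ)ᴺ = (ℝᵈ)ᴺ × (ℝᵈ)ᴺ` (base points first, velocities second). -/
noncomputable def tensor (V : Fin N → Measure (Space d × Space d)) :
    Measure (Ensemble d N × Ensemble d N) :=
  (Measure.pi V).map
    (fun z => (WithLp.toLp 2 (fun i => (z i).1), WithLp.toLp 2 (fun i => (z i).2)))

/-- The multivalued vector field `𝒱[μ] = ⨂ᵢ (π₀, π₁ - π₀)_# Γₒ(μⁱ, Bar)`. Different agents may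
use different barycenters. -/
def field (lam : P2 (Space d) → ℝ) (μ : P2 (Ensemble d N)) :
    Set (Measure (Ensemble d N × Ensemble d N)) :=
  {W | ∃ γ : Fin N → Measure (Space d × Space d),
    (∀ i, ∃ ν ∈ Bar lam μ, γ i ∈ optCouplings (agent μ i) ν) ∧
      W = tensor (fun i => (γ i).map (fun p => (p.1, p.2 - p.1)))}

/-- The pairing `⟨∇φ, W⟩ = ∫ v · ∇φ(x) W(dx, dv)`; here `v · ∇φ(x)` is the derivative of `φ` at
`x` in the direction `v`. -/
noncomputable def gradPairing (φ : Ensemble d N → ℝ)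
    (W : Measure (Ensemble d N × Ensemble d N)) : ℝ :=
  ∫ p, fderiv ℝ φ p.1 p.2 ∂W

/-- The solutions on `[0, T]` of the measure differential inclusion `μ̇ₜ ∈ 𝒱[μₜ]`: the curves in
`C([0, T], P₂((ℝᵈ)ᴺ))` such that, for each test function `φ`, the function `t ↦ ∫ φ dμₜ` is
absolutely continuous on `[0, T]` (so that it is the integral of its derivative) and its
derivative lies in `{⟨∇φ, W⟩ : W ∈ 𝒱[μₜ]}` for almost every `t`. Only the values of the curve on
`[0, T]` matter. -/
def Sol (lam : P2 (Space d) → ℝ) (T : ℝ) : Set (ℝ → P2 (Ensemble d N)) :=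
  {μ | W2ContinuousOn T μ ∧
    ∀ φ : Ensemble d N → ℝ, ContDiff ℝ ∞ φ → HasCompactSupport φ →
      AbsolutelyContinuousOnInterval (fun t => ∫ x, φ x ∂(μ t).toMeasure) 0 T ∧
      ∀ᵐ t ∂(volume.restrict (Icc 0 T)), ∃ W ∈ field lam (μ t),
        HasDerivWithinAt (fun s => ∫ x, φ x ∂(μ s).toMeasure) (gradPairing φ W) (Icc 0 T) t}

end ConsensusMDI

namespace ConsensusMDI

/-! Fix a test function φ. The inclusion sees the curve only through `f t = ∫ φ dμₜ` and the set `S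
t` of pairings `⟨∇φ, W⟩`, `W ∈ 𝒱[μₜ]`, and `W` may depend on φ. So the claim reduces to stability of
a scalar inclusion `f' ∈ S t` (`SolvesInclusion.of_tendsto`), which needs two properties of these
sets.

Compactness with closed graph (`exists_subseq_gradPairing`): along a `W2`-convergent sequence the
barycenters have bounded second moments, since each agent is itself a competitor; hence the plans
are tight. Lower semicontinuity of the cost, set against convergence of the functional at a fixed
competitor, makes the limit a barycenter. As every weight is positive, equality of the weighted sums
forces each single cost to converge, so the limit plan is optimal.

Interval values (`ordConnected_pairings`): product measures are not stable under mixtures, but for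
one agent a mixture of optimal plans to barycenters is again such a plan. The pairing is affine in
each factor, so exchanging plans agent by agent covers every intermediate value.

In the scalar problem the limit is Lipschitz. If every element of `S t` exceeded the derivative `D`,
nearby approximating sets would stay above `D + ε`, and integration would contradict the slope. The
mirror argument gives an element on the other side, and the interval property puts `D` in `S t`.
Continuity and the Lipschitz bound follow from `W2_triangle`. -/

lemma ennreal_add_sq_le (a b : ℝ≥0∞) : (a + b) ^ 2 ≤ 2 * a ^ 2 + 2 * b ^ 2 := by
  induction a with
  | top => simp
  | coe a =>
    induction b with
    | top => simp
    | coe b =>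
      norm_cast
      rw [← mul_add]
      exact add_sq_le

/-! ### Elementary properties of the Wasserstein distance -/

section Wasserstein

variable {X : Type*} [NormedAddCommGroup X] [MeasurableSpace X]

lemma isProbabilityMeasure_of_mem_couplings {μ ν : P2 X} {γ : Measure (X × X)}
    (h : γ ∈ couplings μ ν) : IsProbabilityMeasure γ :=
  ⟨by rw [← Measure.fst_univ, h.1, measure_univ]⟩

lemma W2sq_le_cost {μ ν : P2 X} {γ : Measure (X × X)} (h : γ ∈ couplings μ ν) :
    W2sq μ ν ≤ cost γ :=
  iInf₂_le γ h

lemma exists_coupling_cost_lt {μ ν : P2 X} {a : ℝ≥0∞} (h : W2sq μ ν < a) :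
    ∃ γ ∈ couplings μ ν, cost γ < a := by
  simpa only [W2sq, iInf_lt_iff, exists_prop] using h

lemma W2_sq (μ ν : P2 X) : W2 μ ν ^ 2 = W2sq μ ν := by
  rw [W2, ← ENNReal.rpow_natCast, ← ENNReal.rpow_mul]
  norm_num

lemma W2_le_iff {μ ν : P2 X} {a : ℝ≥0∞} : W2 μ ν ≤ a ↔ W2sq μ ν ≤ a ^ 2 := by
  rw [← W2_sq]
  exact (ENNReal.pow_le_pow_left_iff two_ne_zero).symm

lemma prod_mem_couplings (μ ν : P2 X) : μ.toMeasure.prod ν.toMeasure ∈ couplings μ ν :=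
  ⟨by simp, by simp⟩

lemma W2_eq_iInf (μ ν : P2 X) : W2 μ ν = ⨅ γ ∈ couplings μ ν, cost γ ^ (1 / 2 : ℝ) := by
  have h : (0 : ℝ) < 1 / 2 := by norm_num
  change ENNReal.orderIsoRpow (1 / 2 : ℝ) h (⨅ γ ∈ couplings μ ν, cost γ) = _
  simp only [OrderIso.map_iInf]
  rfl

lemma cost_rpow_half (γ : Measure (X × X)) :
    cost γ ^ (1 / 2 : ℝ) = eLpNorm (fun p : X × X => p.1 - p.2) 2 γ := by
  rw [eLpNorm_eq_lintegral_rpow_enorm_toReal (by norm_num) (by norm_num)]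
  simp [cost]

variable [BorelSpace X] [SecondCountableTopology X]

omit [BorelSpace X] [SecondCountableTopology X] in
lemma swap_mem_couplings {μ ν : P2 X} {γ : Measure (X × X)} (h : γ ∈ couplings μ ν) :
    γ.map Prod.swap ∈ couplings ν μ :=
  ⟨by rw [Measure.fst_map_swap, h.2], by rw [Measure.snd_map_swap, h.1]⟩

lemma cost_swap (γ : Measure (X × X)) : cost (γ.map Prod.swap) = cost γ := by
  rw [cost, lintegral_map (by fun_prop) (by fun_prop)]
  simp only [cost, Prod.fst_swap, Prod.snd_swap]
  refine lintegral_congr fun p => ?_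
  rw [← enorm_neg, neg_sub]

lemma W2sq_comm (μ ν : P2 X) : W2sq μ ν = W2sq ν μ := by
  have key (μ ν : P2 X) : W2sq μ ν ≤ W2sq ν μ :=
    le_iInf₂ fun γ hγ => (W2sq_le_cost (swap_mem_couplings hγ)).trans (cost_swap γ).le
  exact le_antisymm (key μ ν) (key ν μ)

lemma W2_comm (μ ν : P2 X) : W2 μ ν = W2 ν μ := by
  rw [W2, W2, W2sq_comm]

lemma lintegral_enorm_fst_sq {μ ν : P2 X} {γ : Measure (X × X)} (h : γ ∈ couplings μ ν) :
    ∫⁻ p, ‖p.1‖ₑ ^ 2 ∂γ = ∫⁻ x, ‖x‖ₑ ^ 2 ∂μ.toMeasure := by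
  rw [← h.1, Measure.fst, lintegral_map (by fun_prop) (by fun_prop)]

lemma lintegral_enorm_snd_sq {μ ν : P2 X} {γ : Measure (X × X)} (h : γ ∈ couplings μ ν) :
    ∫⁻ p, ‖p.2‖ₑ ^ 2 ∂γ = ∫⁻ x, ‖x‖ₑ ^ 2 ∂ν.toMeasure := by
  rw [← h.2, Measure.snd, lintegral_map (by fun_prop) (by fun_prop)]

lemma cost_le_moments {μ ν : P2 X} {γ : Measure (X × X)} (h : γ ∈ couplings μ ν) :
    cost γ ≤ 2 * ∫⁻ x, ‖x‖ₑ ^ 2 ∂μ.toMeasure + 2 * ∫⁻ x, ‖x‖ₑ ^ 2 ∂ν.toMeasure := by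
  rw [← lintegral_enorm_fst_sq h, ← lintegral_enorm_snd_sq h,
    ← lintegral_const_mul _ (by fun_prop), ← lintegral_const_mul _ (by fun_prop),
    ← lintegral_add_left (by fun_prop)]
  refine lintegral_mono fun p => le_trans ?_ (ennreal_add_sq_le _ _)
  gcongr
  exact enorm_sub_le

lemma W2sq_le_moments (μ ν : P2 X) :
    W2sq μ ν ≤ 2 * ∫⁻ x, ‖x‖ₑ ^ 2 ∂μ.toMeasure + 2 * ∫⁻ x, ‖x‖ₑ ^ 2 ∂ν.toMeasure :=
  (W2sq_le_cost (prod_mem_couplings μ ν)).trans (cost_le_moments (prod_mem_couplings μ ν))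

lemma W2sq_lt_top (μ ν : P2 X) : W2sq μ ν < ⊤ :=
  (W2sq_le_moments μ ν).trans_lt <| ENNReal.add_lt_top.2
    ⟨ENNReal.mul_lt_top (by simp) μ.moment, ENNReal.mul_lt_top (by simp) ν.moment⟩

lemma W2_lt_top (μ ν : P2 X) : W2 μ ν < ⊤ :=
  ENNReal.rpow_lt_top_of_nonneg (by norm_num) (W2sq_lt_top μ ν).ne

lemma moment_fst_le {μ ν : P2 X} {γ : Measure (X × X)} (h : γ ∈ couplings μ ν) :
    ∫⁻ x, ‖x‖ₑ ^ 2 ∂μ.toMeasure ≤ 2 * cost γ + 2 * ∫⁻ x, ‖x‖ₑ ^ 2 ∂ν.toMeasure := by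
  rw [← lintegral_enorm_fst_sq h, ← lintegral_enorm_snd_sq h, cost,
    ← lintegral_const_mul _ (by fun_prop), ← lintegral_const_mul _ (by fun_prop),
    ← lintegral_add_left (by fun_prop)]
  refine lintegral_mono fun p => le_trans ?_ (ennreal_add_sq_le _ _)
  gcongr
  calc ‖p.1‖ₑ = ‖(p.1 - p.2) + p.2‖ₑ := by simp
    _ ≤ _ := enorm_add_le _ _

lemma moment_le_W2sq (μ ν : P2 X) :
    ∫⁻ x, ‖x‖ₑ ^ 2 ∂μ.toMeasure ≤ 2 * W2sq μ ν + 2 * ∫⁻ x, ‖x‖ₑ ^ 2 ∂ν.toMeasure := by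
  rw [W2sq, ENNReal.mul_iInf_of_ne (by simp) (by simp), ENNReal.iInf_add]
  refine le_iInf fun γ => ?_
  rw [ENNReal.mul_iInf_of_ne (by simp) (by simp), ENNReal.iInf_add]
  exact le_iInf fun hγ => moment_fst_le hγ

/-- Integrate the Lipschitz bound against any plan and use that the `L¹` norm is at most the `L²`
norm for a probability measure. -/
lemma edist_integral_le_mul_W2 {f : X → ℝ} {L : NNReal} (hf : LipschitzWith L f) (μ ν : P2 X)
    (hμ : Integrable f μ.toMeasure) (hν : Integrable f ν.toMeasure) :
    edist (∫ x, f x ∂μ.toMeasure) (∫ x, f x ∂ν.toMeasure) ≤ L * W2 μ ν := by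
  rw [W2_eq_iInf]
  -- Moving `L` inside the infimum requires `L ≠ 0`; a `0`-Lipschitz function is constant.
  by_cases hL : L = 0
  · subst hL
    obtain ⟨c, hc⟩ : ∃ c, f = fun _ => c := ⟨f 0, funext fun x => by
      simpa using hf x 0⟩
    simp [hc]
  rw [ENNReal.mul_iInf_of_ne (by simpa using hL) (by simp)]
  refine le_iInf fun γ => ?_
  rw [ENNReal.mul_iInf_of_ne (by simpa using hL) (by simp)]
  refine le_iInf fun hγ => ?_
  have := isProbabilityMeasure_of_mem_couplings hγ
  have e1 : ∫ x, f x ∂μ.toMeasure = ∫ p, f p.1 ∂γ := by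
    rw [← hγ.1, Measure.fst, integral_map (by fun_prop) hf.continuous.aestronglyMeasurable]
  have e2 : ∫ x, f x ∂ν.toMeasure = ∫ p, f p.2 ∂γ := by
    rw [← hγ.2, Measure.snd, integral_map (by fun_prop) hf.continuous.aestronglyMeasurable]
  have i1 : Integrable (fun p : X × X => f p.1) γ := by
    rw [← hγ.1] at hμ
    exact hμ.comp_measurable measurable_fst
  have i2 : Integrable (fun p : X × X => f p.2) γ := by
    rw [← hγ.2] at hν
    exact hν.comp_measurable measurable_snd
  rw [e1, e2, edist_eq_enorm_sub, ← integral_sub i1 i2, cost_rpow_half]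
  calc _ ≤ ∫⁻ p, ‖f p.1 - f p.2‖ₑ ∂γ := enorm_integral_le_lintegral_enorm _
    _ ≤ ∫⁻ p, L * ‖p.1 - p.2‖ₑ ∂γ := by
        refine lintegral_mono fun p => ?_
        simpa [edist_eq_enorm_sub] using hf p.1 p.2
    _ = L * eLpNorm (fun p : X × X => p.1 - p.2) 1 γ := by
        rw [lintegral_const_mul _ (by fun_prop), eLpNorm_one_eq_lintegral_enorm]
    _ ≤ _ := by
        gcongr
        exact eLpNorm_le_eLpNorm_of_exponent_le (by norm_num) (by fun_prop)

/-- The element of `ProbabilityMeasure X`, which carries the weak topology, underlying `μ`. -/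
def P2.toProb (μ : P2 X) : ProbabilityMeasure X := ⟨μ.toMeasure, μ.isProb⟩

lemma tendsto_toProb {u : ℕ → P2 X} {m : P2 X} (h : Tendsto (fun n => W2 (u n) m) atTop (𝓝 0)) :
    Tendsto (fun n => (u n).toProb) atTop (𝓝 m.toProb) := by
  rw [tendsto_iff_forall_lipschitz_integral_tendsto]
  rintro f ⟨C, hC⟩ ⟨L, hL⟩
  have hi (μ : P2 X) : Integrable f μ.toMeasure := by
    refine Integrable.of_bound hL.continuous.aestronglyMeasurable (C + ‖f 0‖)
      (Eventually.of_forall fun x => ?_)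
    have := hC x 0
    rw [dist_eq_norm] at this
    calc ‖f x‖ = ‖(f x - f 0) + f 0‖ := by simp
      _ ≤ _ := (norm_add_le _ _).trans (by gcongr)
  rw [tendsto_iff_edist_tendsto_0]
  refine tendsto_of_tendsto_of_tendsto_of_le_of_le tendsto_const_nhds
    (g := fun _ => 0) (h := fun n => L * W2 (u n) m) ?_ (fun _ => zero_le)
    fun n => edist_integral_le_mul_W2 hL (u n) m (hi _) (hi _)
  simpa using ENNReal.Tendsto.const_mul h (Or.inr (by simp))

end Wasserstein

/-! ### Gluing of plans and the triangle inequality -/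

section Triangle

variable {X : Type*} [NormedAddCommGroup X] [MeasurableSpace X] [BorelSpace X]
  [SecondCountableTopology X] [CompleteSpace X]

/-- Disintegrate both plans over the common marginal `ν` and make the outer points conditionally
independent. The shared point is the first coordinate of `π`. -/
lemma exists_gluing {μ ν ρ : P2 X} {γ₁ γ₂ : Measure (X × X)} (h₁ : γ₁ ∈ couplings μ ν)
    (h₂ : γ₂ ∈ couplings ν ρ) :
    ∃ π : Measure (X × X × X), π.map (fun q => (q.2.1, q.1)) = γ₁ ∧
      π.map (fun q => (q.1, q.2.2)) = γ₂ := by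
  have := isProbabilityMeasure_of_mem_couplings h₁
  have := isProbabilityMeasure_of_mem_couplings h₂
  have : IsProbabilityMeasure (γ₁.map Prod.swap) :=
    Measure.isProbabilityMeasure_map (by fun_prop)
  have e₁ : ν.toMeasure.compProd (γ₁.map Prod.swap).condKernel = γ₁.map Prod.swap := by
    conv_lhs => rw [← (swap_mem_couplings h₁).1]
    exact Measure.disintegrate _ _
  have e₂ : ν.toMeasure.compProd γ₂.condKernel = γ₂ := by
    conv_lhs => rw [← h₂.1]
    exact Measure.disintegrate _ _
  refine ⟨ν.toMeasure.compProd (ProbabilityTheory.Kernel.prod (γ₁.map Prod.swap).condKernel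
    γ₂.condKernel), ?_, ?_⟩
  · have h := Measure.compProd_map (μ := ν.toMeasure) (κ := ProbabilityTheory.Kernel.prod
      (γ₁.map Prod.swap).condKernel γ₂.condKernel) (f := Prod.fst) measurable_fst
    rw [← ProbabilityTheory.Kernel.fst_eq, ProbabilityTheory.Kernel.fst_prod, e₁] at h
    have h' := congrArg (Measure.map Prod.swap) h
    rw [Measure.map_map (by fun_prop) (by fun_prop), Measure.map_map (by fun_prop) (by fun_prop),
      Prod.swap_swap_eq, Measure.map_id] at h'
    exact h'.symm
  · have h := Measure.compProd_map (μ := ν.toMeasure) (κ := ProbabilityTheory.Kernel.prod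
      (γ₁.map Prod.swap).condKernel γ₂.condKernel) (f := Prod.snd) measurable_snd
    rw [← ProbabilityTheory.Kernel.snd_eq, ProbabilityTheory.Kernel.snd_prod, e₂] at h
    exact h.symm

/-- Minkowski's inequality in `L²` of the glued measure. -/
lemma W2_triangle (μ ν ρ : P2 X) : W2 μ ρ ≤ W2 μ ν + W2 ν ρ := by
  rw [W2_eq_iInf μ ν, W2_eq_iInf ν ρ]
  simp_rw [ENNReal.iInf_add, ENNReal.add_iInf]
  refine le_iInf₂ fun γ₁ h₁ => le_iInf₂ fun γ₂ h₂ => ?_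
  obtain ⟨π, hπ₁, hπ₂⟩ := exists_gluing h₁ h₂
  have hc : π.map (fun q => (q.2.1, q.2.2)) ∈ couplings μ ρ := by
    constructor
    · rw [← h₁.1, ← hπ₁, Measure.fst, Measure.fst, Measure.map_map (by fun_prop) (by fun_prop),
        Measure.map_map (by fun_prop) (by fun_prop)]
      rfl
    · rw [← h₂.2, ← hπ₂, Measure.snd, Measure.snd, Measure.map_map (by fun_prop) (by fun_prop),
        Measure.map_map (by fun_prop) (by fun_prop)]
      rfl
  calc W2 μ ρ ≤ cost (π.map (fun q => (q.2.1, q.2.2))) ^ (1 / 2 : ℝ) := by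
        rw [W2_eq_iInf]
        exact iInf₂_le _ hc
    _ = eLpNorm ((fun q : X × X × X => q.2.1 - q.1) + fun q => q.1 - q.2.2) 2 π := by
        rw [cost_rpow_half, eLpNorm_map_measure (by fun_prop) (by fun_prop)]
        congr 1
        ext q
        simp
    _ ≤ eLpNorm (fun q : X × X × X => q.2.1 - q.1) 2 π +
          eLpNorm (fun q : X × X × X => q.1 - q.2.2) 2 π :=
        eLpNorm_add_le (by fun_prop) (by fun_prop) (by norm_num)
    _ = _ := by
        rw [← hπ₁, ← hπ₂, cost_rpow_half, cost_rpow_half,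
          eLpNorm_map_measure (by fun_prop) (by fun_prop),
          eLpNorm_map_measure (by fun_prop) (by fun_prop)]
        rfl

end Triangle

/-! ### Weak limits under second moment bounds -/

section WeakLimits

variable {E : Type*} [NormedAddCommGroup E] [MeasurableSpace E] [BorelSpace E]

/-- Chebyshev's inequality gives tightness, and Prokhorov's theorem gives compactness. -/
lemma isCompact_closure_moment_le [ProperSpace E] {B : ℝ≥0∞} (hB : B < ⊤) :
    IsCompact (closure {P : ProbabilityMeasure E | ∫⁻ x, ‖x‖ₑ ^ 2 ∂(P : Measure E) ≤ B}) := by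
  have : SecondCountableTopology E := inferInstance
  refine isCompact_closure_of_isTightMeasureSet (isTightMeasureSet_of_tendsto_measure_norm_gt ?_)
  have hlim : Tendsto (fun r : ℝ => B / ENNReal.ofReal r ^ 2) atTop (𝓝 0) := by
    rw [← ENNReal.div_top (a := B)]
    refine ENNReal.Tendsto.const_div ?_ (Or.inr hB.ne)
    have := (ENNReal.continuous_pow 2).tendsto ⊤
    rw [ENNReal.top_pow two_ne_zero] at this
    exact this.comp ENNReal.tendsto_ofReal_atTop
  refine tendsto_of_tendsto_of_tendsto_of_le_of_le' tendsto_const_nhds hlim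
    (Eventually.of_forall fun _ => zero_le) ?_
  filter_upwards [eventually_gt_atTop 0] with r hr
  refine iSup₂_le ?_
  rintro _ ⟨P, hP, rfl⟩
  calc (P : Measure E) {x | r < ‖x‖}
      ≤ (P : Measure E) {x | ENNReal.ofReal r ^ 2 ≤ ‖x‖ₑ ^ 2} := by
        refine measure_mono fun x hx => ?_
        simp only [mem_ofPred_eq] at hx ⊢
        gcongr
        rw [← ofReal_norm]
        exact ENNReal.ofReal_le_ofReal hx.le
    _ ≤ (∫⁻ x, ‖x‖ₑ ^ 2 ∂(P : Measure E)) / ENNReal.ofReal r ^ 2 :=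
        meas_ge_le_lintegral_div (by fun_prop) (by simp [hr]) (by finiteness)
    _ ≤ B / ENNReal.ofReal r ^ 2 := by gcongr

variable {Ω : Type*} [MeasurableSpace Ω] [TopologicalSpace Ω] [OpensMeasurableSpace Ω]
  [HasOuterApproxClosed Ω]

/-- The portmanteau bound on open sets yields a Fatou inequality for nonnegative continuous
integrands. -/
lemma lintegral_enorm_sq_le_of_tendsto {F : Type*} [NormedAddCommGroup F]
    {P : ℕ → ProbabilityMeasure Ω} {P₀ : ProbabilityMeasure Ω} (hP : Tendsto P atTop (𝓝 P₀))
    {g : Ω → F} (hg : Continuous g) {a : ℕ → ℝ≥0∞} {b : ℝ≥0∞} (ha : Tendsto a atTop (𝓝 b))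
    (h : ∀ᶠ k in atTop, ∫⁻ x, ‖g x‖ₑ ^ 2 ∂(P k : Measure Ω) ≤ a k) :
    ∫⁻ x, ‖g x‖ₑ ^ 2 ∂(P₀ : Measure Ω) ≤ b := by
  have e (x : Ω) : ‖g x‖ₑ ^ 2 = ENNReal.ofReal (‖g x‖ ^ 2) := by
    rw [ENNReal.ofReal_pow (norm_nonneg _), ofReal_norm]
  simp_rw [e] at h ⊢
  refine (lintegral_le_liminf_lintegral_of_forall_isOpen_measure_le_liminf_measure
    (μs := fun k => (P k : Measure Ω)) (by fun_prop) (fun x => by positivity)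
    fun G hG => ProbabilityMeasure.le_liminf_measure_open_of_tendsto hP hG).trans ?_
  rw [← ha.liminf_eq]
  exact liminf_le_liminf h

/-- Truncating `g` at height `R` changes it pointwise by at most `g ^ 2 / R`, hence every integral
by at most `B / R`, uniformly in `k`; the truncation is bounded and continuous. -/
lemma tendsto_integral_of_moment_le
    {P : ℕ → ProbabilityMeasure Ω} {P₀ : ProbabilityMeasure Ω} (hP : Tendsto P atTop (𝓝 P₀))
    {g : Ω → ℝ} (hg : Continuous g) {B : ℝ≥0∞} (hB : B < ⊤)
    (h : ∀ k, ∫⁻ x, ‖g x‖ₑ ^ 2 ∂(P k : Measure Ω) ≤ B) :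
    Tendsto (fun k => ∫ x, g x ∂(P k : Measure Ω)) atTop (𝓝 (∫ x, g x ∂(P₀ : Measure Ω))) := by
  have h₀ : ∫⁻ x, ‖g x‖ₑ ^ 2 ∂(P₀ : Measure Ω) ≤ B :=
    lintegral_enorm_sq_le_of_tendsto hP hg tendsto_const_nhds (Eventually.of_forall h)
  have key (Q : ProbabilityMeasure Ω) (hQ : ∫⁻ x, ‖g x‖ₑ ^ 2 ∂(Q : Measure Ω) ≤ B)
      (R : ℝ) (hR : 0 < R) :
      |∫ x, g x ∂(Q : Measure Ω) - ∫ x, max (-R) (min R (g x)) ∂(Q : Measure Ω)|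
        ≤ B.toReal / R := by
    have hm : MemLp g 2 (Q : Measure Ω) := by
      refine ⟨hg.aestronglyMeasurable, ?_⟩
      rw [eLpNorm_lt_top_iff_lintegral_rpow_enorm_lt_top (by norm_num) (by norm_num)]
      simpa using hQ.trans_lt hB
    have hi := hm.integrable_sq
    have hs : ∫ x, g x ^ 2 ∂(Q : Measure Ω) ≤ B.toReal := by
      rw [integral_eq_lintegral_of_nonneg_ae (Eventually.of_forall fun x => sq_nonneg _)
        hi.aestronglyMeasurable]
      refine ENNReal.toReal_mono hB.ne (le_trans (lintegral_mono fun x => ?_) hQ)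
      rw [← ofReal_norm, ← ENNReal.ofReal_pow (norm_nonneg _), Real.norm_eq_abs, sq_abs]
    have hb : Integrable (fun x => max (-R) (min R (g x))) (Q : Measure Ω) := by
      refine Integrable.of_bound (by fun_prop) R (Eventually.of_forall fun x => ?_)
      rw [Real.norm_eq_abs, abs_le]
      exact ⟨le_max_left _ _, max_le (by linarith) (min_le_left _ _)⟩
    rw [← integral_sub (hm.integrable (by norm_num)) hb, ← Real.norm_eq_abs]
    calc _ ≤ ∫ x, g x ^ 2 / R ∂(Q : Measure Ω) := by
          refine norm_integral_le_of_norm_le (hi.div_const R) (Eventually.of_forall fun x => ?_)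
          rw [Real.norm_eq_abs, le_div_iff₀ hR]
          rcases le_total (g x) R with h1 | h1
          · rw [min_eq_right h1]
            rcases le_total (-R) (g x) with h2 | h2
            · rw [max_eq_right h2]; simp; positivity
            · rw [max_eq_left h2, abs_of_nonpos (by linarith)]; nlinarith
          · rw [min_eq_left h1, max_eq_right (by linarith), abs_of_nonneg (by linarith)]; nlinarith
      _ = (∫ x, g x ^ 2 ∂(Q : Measure Ω)) / R := integral_div _ _
      _ ≤ _ := by gcongr
  rw [Metric.tendsto_atTop]
  intro ε hε
  obtain ⟨R, hR, hRε⟩ : ∃ R : ℝ, 0 < R ∧ B.toReal / R < ε / 3 := by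
    refine ⟨(B.toReal + 1) / (ε / 3), by positivity, ?_⟩
    rw [div_div_eq_mul_div, div_lt_iff₀ (by positivity)]
    nlinarith
  let f : BoundedContinuousFunction Ω ℝ := BoundedContinuousFunction.ofNormedAddCommGroup
    (fun x => max (-R) (min R (g x))) (by fun_prop) R fun x => by
      rw [Real.norm_eq_abs, abs_le]
      exact ⟨le_max_left _ _, max_le (by linarith) (min_le_left _ _)⟩
  have hf := ProbabilityMeasure.tendsto_iff_forall_integral_tendsto.1 hP f
  rw [Metric.tendsto_atTop] at hf
  obtain ⟨K, hK⟩ := hf (ε / 3) (by positivity)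
  refine ⟨K, fun k hk => ?_⟩
  have h1 := abs_le.1 (key (P k) (h k) R hR)
  have h2 := abs_le.1 (key P₀ h₀ R hR)
  have h3 := hK k hk
  rw [Real.dist_eq] at h3 ⊢
  have h4 := abs_lt.1 h3
  change _ < (∫ x, max (-R) (min R (g x)) ∂(P k : Measure Ω)) -
    (∫ x, max (-R) (min R (g x)) ∂(P₀ : Measure Ω)) ∧ (∫ x, max (-R) (min R (g x)) ∂(P k : Measure Ω)) -
    (∫ x, max (-R) (min R (g x)) ∂(P₀ : Measure Ω)) < _ at h4
  rw [abs_lt]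
  constructor <;> linarith [h1.1, h1.2, h2.1, h2.2, h4.1, h4.2]

end WeakLimits

/-- One strict inequality, with a positive finite weight, would make the weighted sums differ. This
turns minimality of a sum into information on each agent. -/
lemma eq_of_sum_mul_le {ι : Type*} [Fintype ι] {c a b : ι → ℝ≥0∞} (hc : ∀ i, c i ≠ 0)
    (hc' : ∀ i, c i ≠ ⊤) (hab : ∀ i, a i ≤ b i) (h : ∑ i, c i * b i ≤ ∑ i, c i * a i)
    (ht : ∑ i, c i * a i ≠ ⊤) (i : ι) : a i = b i := by
  classical
  by_contra hne
  have hlt : a i < b i := lt_of_le_of_ne (hab i) hne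
  refine absurd h (not_le.2 ?_)
  rw [← Finset.add_sum_erase _ _ (Finset.mem_univ i),
    ← Finset.add_sum_erase _ (fun i => c i * b i) (Finset.mem_univ i)]
  refine ENNReal.add_lt_add_of_lt_of_le ?_ (ENNReal.mul_lt_mul_right (hc i) (hc' i) hlt)
    (Finset.sum_le_sum fun j _ => by gcongr; exact hab j)
  rw [← Finset.add_sum_erase _ _ (Finset.mem_univ i)] at ht
  exact (ENNReal.add_ne_top.1 ht).2

/-! ### Limits of plans and semicontinuity of the cost -/

section Wasserstein

variable {X : Type*} [NormedAddCommGroup X] [MeasurableSpace X] [BorelSpace X]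
  [SecondCountableTopology X]

lemma lintegral_enorm_sq_le_of_mem_couplings {μ ν : P2 X} {γ : Measure (X × X)}
    (h : γ ∈ couplings μ ν) {B : ℝ≥0∞} (hμ : ∫⁻ x, ‖x‖ₑ ^ 2 ∂μ.toMeasure ≤ B)
    (hν : ∫⁻ x, ‖x‖ₑ ^ 2 ∂ν.toMeasure ≤ B) : ∫⁻ p, ‖p‖ₑ ^ 2 ∂γ ≤ B + B := by
  calc ∫⁻ p, ‖p‖ₑ ^ 2 ∂γ ≤ ∫⁻ p, (‖p.1‖ₑ ^ 2 + ‖p.2‖ₑ ^ 2) ∂γ := by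
        refine lintegral_mono fun p => ?_
        have e : ‖p‖ₑ = ‖p.1‖ₑ ⊔ ‖p.2‖ₑ := by
          simp only [enorm_eq_nnnorm, Prod.nnnorm_def, ENNReal.coe_max]
        rw [e]
        rcases le_total ‖p.1‖ₑ ‖p.2‖ₑ with h | h
        · rw [sup_of_le_right h]; exact le_add_self
        · rw [sup_of_le_left h]; exact le_self_add
    _ = _ := by
        rw [lintegral_add_left (by fun_prop), lintegral_enorm_fst_sq h, lintegral_enorm_snd_sq h]
    _ ≤ B + B := by gcongr

lemma mem_couplings_of_tendsto {m ν : ℕ → P2 X} {m₀ ν₀ : P2 X}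
    (hm : Tendsto (fun k => (m k).toProb) atTop (𝓝 m₀.toProb))
    (hν : Tendsto (fun k => (ν k).toProb) atTop (𝓝 ν₀.toProb))
    {γ : ℕ → ProbabilityMeasure (X × X)} {γ₀ : ProbabilityMeasure (X × X)}
    (hγ : ∀ k, (γ k : Measure (X × X)) ∈ couplings (m k) (ν k))
    (hlim : Tendsto γ atTop (𝓝 γ₀)) : (γ₀ : Measure (X × X)) ∈ couplings m₀ ν₀ := by
  constructor
  · have h := ProbabilityMeasure.tendsto_map_of_tendsto_of_continuous γ γ₀ hlim
      (continuous_fst (X := X) (Y := X))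
    have e : (fun k => (γ k).map (continuous_fst (X := X) (Y := X)).measurable.aemeasurable) =
        fun k => (m k).toProb := funext fun k => ProbabilityMeasure.toMeasure_injective (hγ k).1
    rw [e] at h
    exact congrArg ProbabilityMeasure.toMeasure (tendsto_nhds_unique h hm)
  · have h := ProbabilityMeasure.tendsto_map_of_tendsto_of_continuous γ γ₀ hlim
      (continuous_snd (X := X) (Y := X))
    have e : (fun k => (γ k).map (continuous_snd (X := X) (Y := X)).measurable.aemeasurable) =
        fun k => (ν k).toProb := funext fun k => ProbabilityMeasure.toMeasure_injective (hγ k).2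
    rw [e] at h
    exact congrArg ProbabilityMeasure.toMeasure (tendsto_nhds_unique h hν)

/-- Joint lower semicontinuity of the transport cost under weak convergence. -/
lemma W2sq_le_of_tendsto [ProperSpace X] {m ν : ℕ → P2 X} {m₀ ν₀ : P2 X}
    (hm : Tendsto (fun k => (m k).toProb) atTop (𝓝 m₀.toProb))
    (hν : Tendsto (fun k => (ν k).toProb) atTop (𝓝 ν₀.toProb)) {B : ℝ≥0∞} (hB : B < ⊤)
    (hmB : ∀ k, ∫⁻ x, ‖x‖ₑ ^ 2 ∂(m k).toMeasure ≤ B)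
    (hνB : ∀ k, ∫⁻ x, ‖x‖ₑ ^ 2 ∂(ν k).toMeasure ≤ B) {w : ℝ≥0∞}
    (hw : Tendsto (fun k => W2sq (m k) (ν k)) atTop (𝓝 w)) : W2sq m₀ ν₀ ≤ w := by
  -- Almost optimal plans suffice, so existence of optimal ones is not needed; at `k = 0` the excess
  -- is `⊤`, which is harmless.
  have hex (k : ℕ) : ∃ γ ∈ couplings (m k) (ν k), cost γ < W2sq (m k) (ν k) + ((k : ℝ≥0∞))⁻¹ :=
    exists_coupling_cost_lt (ENNReal.lt_add_right (W2sq_lt_top _ _).ne (by simp))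
  choose γ hγ hc using hex
  let P : ℕ → ProbabilityMeasure (X × X) := fun k =>
    ⟨γ k, isProbabilityMeasure_of_mem_couplings (hγ k)⟩
  obtain ⟨P₀, -, φ, hφ, hlim⟩ :=
    (isCompact_closure_moment_le (E := X × X) (ENNReal.add_lt_top.2 ⟨hB, hB⟩)).tendsto_subseq
      (x := P) fun k => subset_closure
        (lintegral_enorm_sq_le_of_mem_couplings (hγ k) (hmB k) (hνB k))
  have hmem := mem_couplings_of_tendsto (hm.comp hφ.tendsto_atTop) (hν.comp hφ.tendsto_atTop)
    (γ := P ∘ φ) (fun k => hγ (φ k)) hlim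
  refine (W2sq_le_cost hmem).trans ?_
  refine lintegral_enorm_sq_le_of_tendsto hlim (g := fun p : X × X => p.1 - p.2) (by fun_prop)
    (a := fun k => W2sq (m (φ k)) (ν (φ k)) + ((φ k : ℝ≥0∞))⁻¹) ?_
    (Eventually.of_forall fun k => (hc (φ k)).le)
  have := (hw.add ENNReal.tendsto_inv_nat_nhds_zero).comp hφ.tendsto_atTop
  simpa using! this

lemma tendsto_W2sq_left [CompleteSpace X] {m : ℕ → P2 X} {m₀ : P2 X}
    (hm : Tendsto (fun k => W2 (m k) m₀) atTop (𝓝 0)) (ν : P2 X) :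
    Tendsto (fun k => W2sq (m k) ν) atTop (𝓝 (W2sq m₀ ν)) := by
  have h : Tendsto (fun k => W2 (m k) ν) atTop (𝓝 (W2 m₀ ν)) := by
    refine tendsto_of_tendsto_of_tendsto_of_le_of_le (g := fun k => W2 m₀ ν - W2 (m k) m₀)
      (h := fun k => W2 (m k) m₀ + W2 m₀ ν) ?_ ?_ (fun k => ?_) fun k => W2_triangle _ _ _
    · simpa using ENNReal.Tendsto.sub (tendsto_const_nhds (x := W2 m₀ ν)) hm
        (Or.inl (W2_lt_top _ _).ne)
    · simpa using hm.add (tendsto_const_nhds (x := W2 m₀ ν))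
    · rw [tsub_le_iff_left, W2_comm (m k) m₀]
      exact W2_triangle _ _ _
  simpa only [Function.comp_def, W2_sq] using ((ENNReal.continuous_pow 2).tendsto _).comp h

end Wasserstein

/-! ### Agents and stability of barycenters -/

variable {d N : ℕ}

lemma W2_agent_le (μ ν : P2 (Ensemble d N)) (i : Fin N) :
    W2 (agent μ i) (agent ν i) ≤ W2 μ ν := by
  rw [W2_le_iff, W2_sq]
  refine le_iInf₂ fun γ hγ => ?_
  have hm : Measurable fun p : Ensemble d N × Ensemble d N => (p.1 i, p.2 i) := by fun_prop
  have hc : γ.map (fun p => (p.1 i, p.2 i)) ∈ couplings (agent μ i) (agent ν i) := by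
    constructor
    · change _ = μ.toMeasure.map (fun x => x i)
      rw [Measure.fst, Measure.map_map (by fun_prop) hm, ← hγ.1, Measure.fst,
        Measure.map_map (by fun_prop) (by fun_prop)]
      rfl
    · change _ = ν.toMeasure.map (fun x => x i)
      rw [Measure.snd, Measure.map_map (by fun_prop) hm, ← hγ.2, Measure.snd,
        Measure.map_map (by fun_prop) (by fun_prop)]
      rfl
  refine (W2sq_le_cost hc).trans ?_
  rw [cost, lintegral_map (by fun_prop) hm]
  refine lintegral_mono fun p => ?_
  have h : ‖p.1 i - p.2 i‖ₑ ≤ ‖p.1 - p.2‖ₑ := by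
    rw [enorm_le_iff_norm_le]
    exact PiLp.norm_apply_le (p.1 - p.2) i
  gcongr

lemma tendsto_W2_agent {m : ℕ → P2 (Ensemble d N)} {m₀ : P2 (Ensemble d N)}
    (hm : Tendsto (fun k => W2 (m k) m₀) atTop (𝓝 0)) (i : Fin N) :
    Tendsto (fun k => W2 (agent (m k) i) (agent m₀ i)) atTop (𝓝 0) :=
  tendsto_of_tendsto_of_tendsto_of_le_of_le tendsto_const_nhds hm (fun _ => zero_le)
    fun _ => W2_agent_le _ _ i

lemma moment_agent_le (μ : P2 (Ensemble d N)) (i : Fin N) :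
    ∫⁻ x, ‖x‖ₑ ^ 2 ∂(agent μ i).toMeasure ≤ ∫⁻ x, ‖x‖ₑ ^ 2 ∂μ.toMeasure := by
  rw [agent, lintegral_map (by fun_prop) (by fun_prop)]
  refine lintegral_mono fun x => ?_
  have h : ‖x i‖ₑ ≤ ‖x‖ₑ := by
    rw [enorm_le_iff_norm_le]
    exact PiLp.norm_apply_le x i
  gcongr

lemma barFunctional_lt_top (lam : P2 (Space d) → ℝ) (μ : P2 (Ensemble d N)) (ν : P2 (Space d)) :
    barFunctional lam μ ν < ⊤ :=
  ENNReal.sum_lt_top.2 fun _ _ => ENNReal.mul_lt_top (by simp) (W2sq_lt_top _ _)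

/-- A weak limit of barycenters is a barycenter, and the transport costs to it converge. -/
lemma mem_Bar_of_tendsto {lam : P2 (Space d) → ℝ} (hcont : W2Continuous lam)
    (hpos : ∀ m, 0 < lam m) {m : ℕ → P2 (Ensemble d N)} {m₀ : P2 (Ensemble d N)}
    (hm : Tendsto (fun k => W2 (m k) m₀) atTop (𝓝 0)) {ν : ℕ → P2 (Space d)} {ν₀ : P2 (Space d)}
    (hbar : ∀ k, ν k ∈ Bar lam (m k))
    (hν : Tendsto (fun k => (ν k).toProb) atTop (𝓝 ν₀.toProb)) {B : ℝ≥0∞} (hB : B < ⊤)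
    (hmB : ∀ k i, ∫⁻ x, ‖x‖ₑ ^ 2 ∂(agent (m k) i).toMeasure ≤ B)
    (hνB : ∀ k, ∫⁻ x, ‖x‖ₑ ^ 2 ∂(ν k).toMeasure ≤ B) {w : Fin N → ℝ≥0∞}
    (hw : ∀ i, Tendsto (fun k => W2sq (agent (m k) i) (ν k)) atTop (𝓝 (w i))) :
    ν₀ ∈ Bar lam m₀ ∧ ∀ i, W2sq (agent m₀ i) ν₀ = w i := by
  have hlam (i : Fin N) : Tendsto (fun k => ENNReal.ofReal (lam (agent (m k) i))) atTop
      (𝓝 (ENNReal.ofReal (lam (agent m₀ i)))) :=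
    ENNReal.tendsto_ofReal (hcont _ _ (tendsto_W2_agent hm i))
  have hlam0 (i : Fin N) : ENNReal.ofReal (lam (agent m₀ i)) ≠ 0 := by simpa using hpos _
  have hlsc (i : Fin N) : W2sq (agent m₀ i) ν₀ ≤ w i :=
    W2sq_le_of_tendsto (tendsto_toProb (tendsto_W2_agent hm i)) hν hB (fun k => hmB k i) hνB (hw i)
  have hle (ν' : P2 (Space d)) :
      ∑ i, ENNReal.ofReal (lam (agent m₀ i)) * w i ≤ barFunctional lam m₀ ν' := by
    refine le_of_tendsto_of_tendsto' (b := atTop) (f := fun k => barFunctional lam (m k) (ν k))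
      (tendsto_finsetSum _ fun i _ => ENNReal.Tendsto.mul (hlam i) (Or.inl (hlam0 i)) (hw i)
        (Or.inr (by simp)))
      (tendsto_finsetSum _ fun i _ => ENNReal.Tendsto.mul (hlam i) (Or.inl (hlam0 i))
        (tendsto_W2sq_left (tendsto_W2_agent hm i) ν') (Or.inr (by simp)))
      fun k => hbar k ν'
  refine ⟨fun ν' => le_trans ?_ (hle ν'), ?_⟩
  · exact Finset.sum_le_sum fun i _ => by gcongr; exact hlsc i
  -- Taking `ν₀` itself as competitor reverses the weighted sum of the inequalities `hlsc`.
  · exact eq_of_sum_mul_le hlam0 (by simp) hlsc (hle ν₀) (barFunctional_lt_top _ _ _).ne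

/-- Barycenters of a `W2`-convergent sequence have bounded second moments. -/
lemma exists_moment_Bar_le {lam : P2 (Space d) → ℝ} (hcont : W2Continuous lam)
    (hpos : ∀ m, 0 < lam m) {m : ℕ → P2 (Ensemble d N)} {m₀ : P2 (Ensemble d N)}
    (hm : Tendsto (fun k => W2 (m k) m₀) atTop (𝓝 0)) :
    ∃ B : ℝ≥0∞, B < ⊤ ∧ ∀ᶠ k in atTop, ∀ i : Fin N,
      ∫⁻ x, ‖x‖ₑ ^ 2 ∂(agent (m k) i).toMeasure ≤ B ∧
      ∀ ν ∈ Bar lam (m k), ∫⁻ x, ‖x‖ₑ ^ 2 ∂ν.toMeasure ≤ B := by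
  obtain ⟨B₁, hB₁, hB₁'⟩ :
      ∃ B₁, B₁ < ⊤ ∧ B₁ = 2 * 1 + 2 * ∫⁻ x, ‖x‖ₑ ^ 2 ∂m₀.toMeasure :=
    ⟨_, ENNReal.add_lt_top.2 ⟨by simp, ENNReal.mul_lt_top (by simp) m₀.moment⟩, rfl⟩
  have h2 : 2 * B₁ < ⊤ := ENNReal.mul_lt_top (by simp) hB₁
  -- `S` bounds the functional at the competitor `agent (m k) i`, hence its minimum. Dividing by
  -- half the limiting weight gives `D i`, a bound on the cost from agent `i` to any barycenter.
  let S : ℝ≥0∞ := ∑ j, ENNReal.ofReal (lam (agent m₀ j) + 1) * (2 * B₁ + 2 * B₁)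
  have h4 : 2 * B₁ + 2 * B₁ < ⊤ := ENNReal.add_lt_top.2 ⟨h2, h2⟩
  have hS : S < ⊤ := ENNReal.sum_lt_top.2 fun _ _ => ENNReal.mul_lt_top (by simp) h4
  let D : Fin N → ℝ≥0∞ := fun i => S / ENNReal.ofReal (lam (agent m₀ i) / 2)
  have hD (i : Fin N) : D i < ⊤ := ENNReal.div_lt_top hS.ne (by simpa using hpos _)
  refine ⟨B₁ + (2 * (∑ i, D i) + 2 * B₁), ?_, ?_⟩
  · have : ∑ i, D i < ⊤ := ENNReal.sum_lt_top.2 fun i _ => hD i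
    exact ENNReal.add_lt_top.2 ⟨hB₁, ENNReal.add_lt_top.2 ⟨ENNReal.mul_lt_top (by simp) this, h2⟩⟩
  have hm1 : ∀ᶠ k in atTop, W2 (m k) m₀ ≤ 1 := hm.eventually (ge_mem_nhds (by simp))
  have hlam (i : Fin N) := hcont _ _ (tendsto_W2_agent hm i)
  have hup : ∀ᶠ k in atTop, ∀ i, lam (agent (m k) i) ≤ lam (agent m₀ i) + 1 :=
    eventually_all.2 fun i => (hlam i).eventually (ge_mem_nhds (by linarith))
  have hlow : ∀ᶠ k in atTop, ∀ i, lam (agent m₀ i) / 2 ≤ lam (agent (m k) i) :=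
    eventually_all.2 fun i => (hlam i).eventually (le_mem_nhds (by linarith [hpos (agent m₀ i)]))
  filter_upwards [hm1, hup, hlow] with k h1 hup hlow i
  have hmom (j : Fin N) : ∫⁻ x, ‖x‖ₑ ^ 2 ∂(agent (m k) j).toMeasure ≤ B₁ := by
    refine (moment_agent_le _ j).trans ((moment_le_W2sq (m k) m₀).trans ?_)
    have : W2sq (m k) m₀ ≤ 1 := by simpa using W2_le_iff.1 h1
    rw [hB₁']
    gcongr
  refine ⟨(hmom i).trans le_self_add, fun ν hν => ?_⟩
  have hW : W2sq (agent (m k) i) ν ≤ D i := by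
    rw [ENNReal.le_div_iff_mul_le (Or.inl (by simpa using hpos _)) (Or.inl (by simp)), mul_comm]
    calc ENNReal.ofReal (lam (agent m₀ i) / 2) * W2sq (agent (m k) i) ν
        ≤ ENNReal.ofReal (lam (agent (m k) i)) * W2sq (agent (m k) i) ν := by
          gcongr; exact hlow i
      _ ≤ barFunctional lam (m k) ν :=
          Finset.single_le_sum (f := fun j => ENNReal.ofReal (lam (agent (m k) j)) *
            W2sq (agent (m k) j) ν) (fun _ _ => zero_le) (Finset.mem_univ i)
      _ ≤ barFunctional lam (m k) (agent (m k) i) := hν _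
      _ ≤ S := Finset.sum_le_sum fun j _ => by
          gcongr
          · exact hup j
          · refine (W2sq_le_moments _ _).trans ?_
            gcongr
            · exact hmom j
            · exact hmom i
  refine ((moment_le_W2sq ν (agent (m k) i)).trans ?_).trans le_add_self
  rw [W2sq_comm]
  gcongr
  · exact hW.trans (Finset.single_le_sum (fun _ _ => zero_le) (Finset.mem_univ i))
  · exact hmom i

/-! ### Closed graph of the pairings -/

/-- Pulling back to the product of the plans gives one fixed continuous integrand, so only the
measure varies when limits or mixtures are taken. -/
lemma gradPairing_tensor {φ : Ensemble d N → ℝ} (hφ : ContDiff ℝ ∞ φ)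
    (γ : Fin N → Measure (Space d × Space d)) [∀ i, IsProbabilityMeasure (γ i)] :
    gradPairing φ (tensor fun i => (γ i).map fun p => (p.1, p.2 - p.1)) =
      ∫ z, fderiv ℝ φ (WithLp.toLp 2 fun i => (z i).1)
        (WithLp.toLp 2 fun i => (z i).2 - (z i).1) ∂Measure.pi γ := by
  have hc : Continuous fun p : Ensemble d N × Ensemble d N => fderiv ℝ φ p.1 p.2 :=
    ((hφ.continuous_fderiv (by simp)).comp continuous_fst).clm_apply continuous_snd
  have : ∀ i, SigmaFinite ((γ i).map fun p : Space d × Space d => (p.1, p.2 - p.1)) := fun i =>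
    have : IsProbabilityMeasure ((γ i).map fun p : Space d × Space d => (p.1, p.2 - p.1)) :=
      Measure.isProbabilityMeasure_map (by fun_prop)
    inferInstance
  rw [gradPairing, tensor, ← Measure.pi_map_pi (fun i => by fun_prop),
    Measure.map_map (by fun_prop) (by fun_prop),
    integral_map (by fun_prop) hc.aestronglyMeasurable]
  rfl

lemma lintegral_enorm_velocity_sq (γ : Fin N → Measure (Space d × Space d))
    [∀ i, IsProbabilityMeasure (γ i)] :
    ∫⁻ z, ‖(WithLp.toLp 2 fun i => (z i).2 - (z i).1 : Ensemble d N)‖ₑ ^ 2 ∂Measure.pi γ =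
      ∑ i, cost (γ i) := by
  have e (z : Fin N → Space d × Space d) :
      ‖(WithLp.toLp 2 fun i => (z i).2 - (z i).1 : Ensemble d N)‖ₑ ^ 2 =
        ∑ i, ‖(z i).1 - (z i).2‖ₑ ^ 2 := by
    rw [← ofReal_norm, ← ENNReal.ofReal_pow (norm_nonneg _), PiLp.norm_sq_eq_of_L2,
      ENNReal.ofReal_sum_of_nonneg (fun _ _ => by positivity)]
    refine Finset.sum_congr rfl fun i _ => ?_
    rw [ENNReal.ofReal_pow (norm_nonneg _), ofReal_norm, ← enorm_neg, neg_sub]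
  simp_rw [e]
  rw [lintegral_finsetSum _ fun i _ => by fun_prop]
  refine Finset.sum_congr rfl fun i _ => ?_
  exact (measurePreserving_eval γ i).lintegral_comp
    (f := fun p : Space d × Space d => ‖p.1 - p.2‖ₑ ^ 2) (by fun_prop)

/-- The multivalued field `μ ↦ {⟨∇φ, W⟩ : W ∈ 𝒱[μ]}` has closed graph and is locally compact. -/
lemma exists_subseq_gradPairing {lam : P2 (Space d) → ℝ} (hcont : W2Continuous lam)
    (hpos : ∀ m, 0 < lam m) {φ : Ensemble d N → ℝ} (hφ : ContDiff ℝ ∞ φ)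
    (hφc : HasCompactSupport φ) {m : ℕ → P2 (Ensemble d N)} {m₀ : P2 (Ensemble d N)}
    (hm : Tendsto (fun k => W2 (m k) m₀) atTop (𝓝 0))
    {W : ℕ → Measure (Ensemble d N × Ensemble d N)} (hW : ∀ k, W k ∈ field lam (m k)) :
    ∃ W₀ ∈ field lam m₀, ∃ ψ : ℕ → ℕ, StrictMono ψ ∧
      Tendsto (fun k => gradPairing φ (W (ψ k))) atTop (𝓝 (gradPairing φ W₀)) := by
  obtain ⟨B, hB, hev⟩ := exists_moment_Bar_le hcont hpos hm
  obtain ⟨K, hK⟩ := eventually_atTop.1 hev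
  replace hm := hm.comp (tendsto_add_atTop_nat K)
  choose γ hγ hWγ using fun k => hW (k + K)
  choose ν hνbar hγopt using hγ
  have hmB (k : ℕ) (i : Fin N) := (hK (k + K) (by simp) i).1
  have hνB (k : ℕ) (i : Fin N) := (hK (k + K) (by simp) i).2 _ (hνbar k i)
  have hprob (k : ℕ) (i : Fin N) : IsProbabilityMeasure (γ k i) :=
    isProbabilityMeasure_of_mem_couplings (hγopt k i).1
  let P : ℕ → Fin N → ProbabilityMeasure (Space d × Space d) := fun k i => ⟨γ k i, hprob k i⟩
  have h2B : B + B < ⊤ := ENNReal.add_lt_top.2 ⟨hB, hB⟩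
  obtain ⟨P₀, -, ψ₁, hψ₁, hlim₁⟩ := (isCompact_univ_pi fun _ : Fin N =>
    isCompact_closure_moment_le (E := Space d × Space d) h2B).tendsto_subseq
      (x := P) fun k i _ => subset_closure
        (lintegral_enorm_sq_le_of_mem_couplings (hγopt k i).1 (hmB k i) (hνB k i))
  -- Limits of the costs exist in the compact space `[0, ∞]`. All pairs are needed: minimality of
  -- the barycenter used by agent `i` involves the costs from every agent `j`.
  obtain ⟨w, ψ₂, hψ₂, hlim₂⟩ := CompactSpace.tendsto_subseq
    (fun k (i j : Fin N) => W2sq (agent (m (ψ₁ k + K)) j) (ν (ψ₁ k) i))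
  let ψ := ψ₁ ∘ ψ₂
  have hψ : StrictMono ψ := hψ₁.comp hψ₂
  have hP : Tendsto (fun k => P (ψ k)) atTop (𝓝 P₀) := hlim₁.comp hψ₂.tendsto_atTop
  have hPi (i : Fin N) : Tendsto (fun k => P (ψ k) i) atTop (𝓝 (P₀ i)) :=
    tendsto_pi_nhds.1 hP i
  have hw (i j : Fin N) :
      Tendsto (fun k => W2sq (agent (m (ψ k + K)) j) (ν (ψ k) i)) atTop (𝓝 (w i j)) :=
    tendsto_pi_nhds.1 (tendsto_pi_nhds.1 hlim₂ i) j
  have hsnd (i : Fin N) : ∫⁻ p, ‖p.2‖ₑ ^ 2 ∂(P₀ i : Measure (Space d × Space d)) ≤ B :=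
    lintegral_enorm_sq_le_of_tendsto (hPi i) continuous_snd tendsto_const_nhds
      (Eventually.of_forall fun k =>
        (lintegral_enorm_snd_sq (hγopt (ψ k) i).1).trans_le (hνB (ψ k) i))
  let ν₀ : Fin N → P2 (Space d) := fun i =>
    { toMeasure := (P₀ i : Measure (Space d × Space d)).snd
      isProb := inferInstance
      moment := by
        rw [Measure.snd, lintegral_map (by fun_prop) (by fun_prop)]
        exact (hsnd i).trans_lt hB }
  have hν (i : Fin N) : Tendsto (fun k => (ν (ψ k) i).toProb) atTop (𝓝 (ν₀ i).toProb) := by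
    have h := ProbabilityMeasure.tendsto_map_of_tendsto_of_continuous _ _ (hPi i)
      (continuous_snd (X := Space d) (Y := Space d))
    have e : (fun k => (P (ψ k) i).map
        (continuous_snd (X := Space d) (Y := Space d)).measurable.aemeasurable) =
        fun k => (ν (ψ k) i).toProb := funext fun k => ProbabilityMeasure.toMeasure_injective (hγopt (ψ k) i).1.2
    rw [e] at h
    exact h
  have hmψ : Tendsto (fun k => W2 (m (ψ k + K)) m₀) atTop (𝓝 0) := hm.comp hψ.tendsto_atTop
  have hlimbar (i : Fin N) := mem_Bar_of_tendsto hcont hpos hmψ (fun k => hνbar (ψ k) i) (hν i) hB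
    (fun k => hmB (ψ k)) (fun k => hνB (ψ k) i) (hw i)
  have hopt (i : Fin N) :
      (P₀ i : Measure (Space d × Space d)) ∈ optCouplings (agent m₀ i) (ν₀ i) := by
    have hc := mem_couplings_of_tendsto (tendsto_toProb (tendsto_W2_agent hmψ i)) (hν i)
      (γ := fun k => P (ψ k) i) (fun k => (hγopt (ψ k) i).1) (hPi i)
    -- The cost of the limit plan is at most the limit of the optimal costs, which
    -- `mem_Bar_of_tendsto` identifies with the optimal cost of the limit.
    refine ⟨hc, le_antisymm ?_ (W2sq_le_cost hc)⟩
    rw [(hlimbar i).2 i]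
    exact lintegral_enorm_sq_le_of_tendsto (hPi i) (g := fun p => p.1 - p.2) (by fun_prop)
      (hw i i) (Eventually.of_forall fun k => (hγopt (ψ k) i).2.le)
  refine ⟨_, ⟨fun i => P₀ i, fun i => ⟨ν₀ i, (hlimbar i).1, hopt i⟩, rfl⟩, fun k => ψ k + K,
    fun a b hab => by simpa using hψ hab, ?_⟩
  simp_rw [hWγ]
  rw [gradPairing_tensor hφ]
  simp_rw [gradPairing_tensor hφ]
  have hfc := hφ.continuous_fderiv (n := ∞) (by simp)
  obtain ⟨C, hC⟩ := hfc.bounded_above_of_compact_support (hφc.fderiv (𝕜 := ℝ))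
  have hpi := (ProbabilityMeasure.continuous_pi.tendsto P₀).comp hP
  -- The integrand is unbounded in the velocity, so weak convergence alone is not enough; its second
  -- moment is at most `C ^ 2` times the total cost of the plans.
  refine tendsto_integral_of_moment_le (P := fun k => ProbabilityMeasure.pi (P (ψ k)))
    (P₀ := ProbabilityMeasure.pi P₀) hpi
    (g := fun z : Fin N → Space d × Space d => fderiv ℝ φ (WithLp.toLp 2 fun i => (z i).1)
        (WithLp.toLp 2 fun i => (z i).2 - (z i).1))
    ((hfc.comp (by fun_prop)).clm_apply (by fun_prop))
    (B := ENNReal.ofReal C ^ 2 * ∑ _i : Fin N, (2 * B + 2 * B)) ?_ fun k => ?_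
  · have : ∑ _i : Fin N, (2 * B + 2 * B) < ⊤ := ENNReal.sum_lt_top.2 fun _ _ => by finiteness
    finiteness
  · calc _ ≤ ∫⁻ z, ENNReal.ofReal C ^ 2 * ‖(WithLp.toLp 2 fun i => (z i).2 - (z i).1 :
          Ensemble d N)‖ₑ ^ 2 ∂Measure.pi (γ (ψ k)) := by
          refine lintegral_mono fun z => ?_
          rw [← mul_pow]
          gcongr
          rw [← ofReal_norm, ← ofReal_norm, ← ENNReal.ofReal_mul ((norm_nonneg _).trans (hC 0))]
          exact ENNReal.ofReal_le_ofReal (ContinuousLinearMap.le_of_opNorm_le _ (hC _) _)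
      _ = ENNReal.ofReal C ^ 2 * ∑ i, cost (γ (ψ k) i) := by
          rw [lintegral_const_mul _ (by fun_prop), lintegral_enorm_velocity_sq]
      _ ≤ _ := by
          gcongr with i
          refine (cost_le_moments (hγopt (ψ k) i).1).trans ?_
          gcongr
          · exact hmB (ψ k) i
          · exact hνB (ψ k) i

/-! ### Mixtures of plans and the interval property -/

section Wasserstein

variable {X : Type*} [NormedAddCommGroup X] [MeasurableSpace X]

/-- The mixture `a • ν₀ + b • ν₁` of two measures in `P2 X`. -/
noncomputable def P2.mix (a b : ℝ≥0∞) (hab : a + b = 1) (ν₀ ν₁ : P2 X) : P2 X where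
  toMeasure := a • ν₀.toMeasure + b • ν₁.toMeasure
  isProb := ⟨by simp [hab]⟩
  moment := by
    have ha : a ≠ ⊤ := fun h => by simp [h] at hab
    have hb : b ≠ ⊤ := fun h => by simp [h] at hab
    rw [lintegral_add_measure, lintegral_smul_measure, lintegral_smul_measure]
    exact ENNReal.add_lt_top.2 ⟨ENNReal.mul_lt_top ha.lt_top ν₀.moment,
      ENNReal.mul_lt_top hb.lt_top ν₁.moment⟩

lemma cost_mix (a b : ℝ≥0∞) (γ₀ γ₁ : Measure (X × X)) :
    cost (a • γ₀ + b • γ₁) = a * cost γ₀ + b * cost γ₁ := by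
  simp only [cost, lintegral_add_measure, lintegral_smul_measure, smul_eq_mul]

lemma mix_mem_couplings {a b : ℝ≥0∞} (hab : a + b = 1) {m ν₀ ν₁ : P2 X}
    {γ₀ γ₁ : Measure (X × X)} (h₀ : γ₀ ∈ couplings m ν₀) (h₁ : γ₁ ∈ couplings m ν₁) :
    a • γ₀ + b • γ₁ ∈ couplings m (P2.mix a b hab ν₀ ν₁) := by
  constructor
  · rw [Measure.fst, Measure.map_add _ _ measurable_fst, Measure.map_smul, Measure.map_smul]
    change a • γ₀.fst + b • γ₁.fst = _
    rw [h₀.1, h₁.1, ← add_smul, hab, one_smul]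
  · rw [Measure.snd, Measure.map_add _ _ measurable_snd, Measure.map_smul, Measure.map_smul]
    change a • γ₀.snd + b • γ₁.snd = _
    rw [h₀.2, h₁.2]
    rfl

/-- Convexity of the transport cost along mixtures. -/
lemma W2sq_mix_le {a b : ℝ≥0∞} (hab : a + b = 1) (m ν₀ ν₁ : P2 X) :
    W2sq m (P2.mix a b hab ν₀ ν₁) ≤ a * W2sq m ν₀ + b * W2sq m ν₁ := by
  have ha : a ≠ ⊤ := fun h => by simp [h] at hab
  have hb : b ≠ ⊤ := fun h => by simp [h] at hab
  rw [W2sq, W2sq, W2sq]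
  -- Since `c` may be `0`, the infimum must run over a nonempty type: an empty one is `⊤`, and `0 *
  -- ⊤ = 0`.
  have mul_iInf' {c : ℝ≥0∞} (hc : c ≠ ⊤) (μ ν : P2 X) :
      c * (⨅ γ ∈ couplings μ ν, cost γ) = ⨅ γ : couplings μ ν, c * cost γ.1 := by
    have : Nonempty (couplings μ ν) := ⟨⟨_, prod_mem_couplings μ ν⟩⟩
    rw [iInf_subtype', ENNReal.mul_iInf fun h => absurd h hc]
  rw [mul_iInf' ha, mul_iInf' hb]
  simp_rw [ENNReal.iInf_add, ENNReal.add_iInf]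
  exact le_iInf fun γ₀ => le_iInf fun γ₁ =>
    (iInf₂_le _ (mix_mem_couplings hab γ₀.2 γ₁.2)).trans_eq (cost_mix _ _ _ _)

end Wasserstein

/-- Convexity bounds each cost to the mixture, while minimality bounds the weighted sum from below;
with positive weights each convexity inequality is then an equality. These equalities make mixed
plans optimal. -/
lemma mix_mem_Bar {lam : P2 (Space d) → ℝ} (hpos : ∀ m, 0 < lam m) {μ : P2 (Ensemble d N)}
    {a b : ℝ≥0∞} (hab : a + b = 1) {ν₀ ν₁ : P2 (Space d)} (h₀ : ν₀ ∈ Bar lam μ)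
    (h₁ : ν₁ ∈ Bar lam μ) :
    P2.mix a b hab ν₀ ν₁ ∈ Bar lam μ ∧ ∀ i, W2sq (agent μ i) (P2.mix a b hab ν₀ ν₁) =
      a * W2sq (agent μ i) ν₀ + b * W2sq (agent μ i) ν₁ := by
  have hsum : ∑ i, ENNReal.ofReal (lam (agent μ i)) *
      (a * W2sq (agent μ i) ν₀ + b * W2sq (agent μ i) ν₁) = barFunctional lam μ ν₀ := by
    calc _ = a * barFunctional lam μ ν₀ + b * barFunctional lam μ ν₁ := by
          rw [barFunctional, barFunctional, Finset.mul_sum, Finset.mul_sum,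
            ← Finset.sum_add_distrib]
          refine Finset.sum_congr rfl fun i _ => by ring
      _ = _ := by rw [le_antisymm (h₁ ν₀) (h₀ ν₁), ← add_mul, hab, one_mul]
  have hle (i : Fin N) := W2sq_mix_le hab (agent μ i) ν₀ ν₁
  refine ⟨fun ν' => le_trans ?_ (h₀ ν'), ?_⟩
  · rw [← hsum]
    exact Finset.sum_le_sum fun i _ => by gcongr; exact hle i
  · exact eq_of_sum_mul_le (c := fun i => ENNReal.ofReal (lam (agent μ i)))
      (fun i => by simpa using hpos _) (by simp) hle (hsum.trans_le (h₀ _))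
      (barFunctional_lt_top _ _ _).ne

/-- `γ` is an optimal plan between the agent `i` of `μ` and some barycenter. -/
def IsBarPlan (lam : P2 (Space d) → ℝ) (μ : P2 (Ensemble d N)) (i : Fin N)
    (γ : Measure (Space d × Space d)) : Prop :=
  ∃ ν ∈ Bar lam μ, γ ∈ optCouplings (agent μ i) ν

lemma IsBarPlan.mix {lam : P2 (Space d) → ℝ} (hpos : ∀ m, 0 < lam m) {μ : P2 (Ensemble d N)}
    {i : Fin N} {a b : ℝ≥0∞} (hab : a + b = 1) {γ₀ γ₁ : Measure (Space d × Space d)}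
    (h₀ : IsBarPlan lam μ i γ₀) (h₁ : IsBarPlan lam μ i γ₁) :
    IsBarPlan lam μ i (a • γ₀ + b • γ₁) := by
  obtain ⟨ν₀, hν₀, hγ₀⟩ := h₀
  obtain ⟨ν₁, hν₁, hγ₁⟩ := h₁
  have h := mix_mem_Bar hpos hab hν₀ hν₁
  refine ⟨_, h.1, mix_mem_couplings hab hγ₀.1 hγ₁.1, ?_⟩
  rw [cost_mix, h.2 i, hγ₀.2, hγ₁.2]

lemma IsBarPlan.isProbabilityMeasure {lam : P2 (Space d) → ℝ} {μ : P2 (Ensemble d N)}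
    {i : Fin N} {γ : Measure (Space d × Space d)} (h : IsBarPlan lam μ i γ) :
    IsProbabilityMeasure γ :=
  let ⟨_, _, hγ⟩ := h
  isProbabilityMeasure_of_mem_couplings hγ.1

lemma IsBarPlan.cost_lt_top {lam : P2 (Space d) → ℝ} {μ : P2 (Ensemble d N)}
    {i : Fin N} {γ : Measure (Space d × Space d)} (h : IsBarPlan lam μ i γ) : cost γ < ⊤ := by
  obtain ⟨ν, _, hγ⟩ := h
  rw [hγ.2]
  exact W2sq_lt_top _ _

/-- A product measure is affine in each factor separately, as is seen on boxes. -/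
lemma pi_update_mix {ι Y : Type*} [Fintype ι] [DecidableEq ι] [MeasurableSpace Y]
    (V : ι → Measure Y) [∀ i, IsProbabilityMeasure (V i)] (i : ι) {a b : ℝ≥0∞} (hab : a + b = 1)
    (A B : Measure Y) [IsProbabilityMeasure A] [IsProbabilityMeasure B] :
    Measure.pi (Function.update V i (a • A + b • B)) =
      a • Measure.pi (Function.update V i A) + b • Measure.pi (Function.update V i B) := by
  have hM : IsProbabilityMeasure (a • A + b • B) := ⟨by simp [hab]⟩
  have inst (M : Measure Y) [IsProbabilityMeasure M] (j : ι) :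
      IsProbabilityMeasure (Function.update V i M j) := by
    rcases eq_or_ne j i with rfl | h
    · simpa
    · simpa [h] using inferInstanceAs (IsProbabilityMeasure (V j))
  have := inst A
  have := inst B
  have := inst (a • A + b • B)
  have key (M : Measure Y) (s : ι → Set Y) : ∏ j, Function.update V i M j (s j) =
      M (s i) * ∏ j ∈ Finset.univ.erase i, V j (s j) := by
    rw [← Finset.mul_prod_erase _ _ (Finset.mem_univ i), Function.update_self]
    congr 1
    refine Finset.prod_congr rfl fun j hj => ?_
    rw [Function.update_of_ne (Finset.ne_of_mem_erase hj)]
  refine Measure.pi_eq fun s _ => ?_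
  simp only [Measure.add_apply, Measure.smul_apply, Measure.pi_pi, key, smul_eq_mul]
  ring

/-- The pairing of `∇φ` with the element of the field generated by the plans `γ`. -/
noncomputable def planPairing (φ : Ensemble d N → ℝ)
    (γ : Fin N → Measure (Space d × Space d)) : ℝ :=
  gradPairing φ (tensor fun i => (γ i).map fun p => (p.1, p.2 - p.1))

lemma integrable_pairing {φ : Ensemble d N → ℝ} (hφ : ContDiff ℝ ∞ φ)
    (hφc : HasCompactSupport φ) (γ : Fin N → Measure (Space d × Space d))
    [∀ i, IsProbabilityMeasure (γ i)] (hγ : ∀ i, cost (γ i) < ⊤) :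
    Integrable (fun z => fderiv ℝ φ (WithLp.toLp 2 fun i => (z i).1)
        (WithLp.toLp 2 fun i => (z i).2 - (z i).1)) (Measure.pi γ) := by
  have hfc := hφ.continuous_fderiv (n := ∞) (by simp)
  obtain ⟨C, hC⟩ := hfc.bounded_above_of_compact_support (hφc.fderiv (𝕜 := ℝ))
  have hv : MemLp (fun z : Fin N → Space d × Space d =>
      (WithLp.toLp 2 fun i => (z i).2 - (z i).1 : Ensemble d N)) 2 (Measure.pi γ) := by
    refine ⟨Continuous.aestronglyMeasurable (by fun_prop), ?_⟩
    rw [eLpNorm_lt_top_iff_lintegral_rpow_enorm_lt_top (by norm_num) (by norm_num)]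
    have := lintegral_enorm_velocity_sq γ
    simp only [ENNReal.toReal_ofNat, ENNReal.rpow_ofNat]
    rw [this]
    exact ENNReal.sum_lt_top.2 fun i _ => hγ i
  refine ((hv.integrable (by norm_num)).norm.const_mul C).mono'
    (Continuous.aestronglyMeasurable ((hfc.comp (by fun_prop)).clm_apply (by fun_prop)))
    (Eventually.of_forall fun z => ContinuousLinearMap.le_of_opNorm_le _ (hC _) _)

lemma planPairing_update_mix {φ : Ensemble d N → ℝ} (hφ : ContDiff ℝ ∞ φ)
    (hφc : HasCompactSupport φ) {lam : P2 (Space d) → ℝ} (hpos : ∀ m, 0 < lam m)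
    {μ : P2 (Ensemble d N)} {γ : Fin N → Measure (Space d × Space d)}
    (hγ : ∀ i, IsBarPlan lam μ i (γ i)) {i : Fin N} {A B : Measure (Space d × Space d)}
    (hA : IsBarPlan lam μ i A) (hB : IsBarPlan lam μ i B) {a b : ℝ≥0∞} (hab : a + b = 1) :
    planPairing φ (Function.update γ i (a • A + b • B)) =
      a.toReal * planPairing φ (Function.update γ i A) +
        b.toReal * planPairing φ (Function.update γ i B) := by
  have ha : a ≠ ⊤ := fun h => by simp [h] at hab
  have hb : b ≠ ⊤ := fun h => by simp [h] at hab
  have hup {M : Measure (Space d × Space d)} (hM : IsBarPlan lam μ i M) (j : Fin N) :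
      IsBarPlan lam μ j (Function.update γ i M j) := by
    rcases eq_or_ne j i with rfl | h
    · simpa
    · simpa [h] using hγ j
  have := fun j => (hγ j).isProbabilityMeasure
  have := hA.isProbabilityMeasure
  have := hB.isProbabilityMeasure
  have := fun j => (hup hA j).isProbabilityMeasure
  have := fun j => (hup hB j).isProbabilityMeasure
  have := fun j => (hup (hA.mix hpos hab hB) j).isProbabilityMeasure
  simp only [planPairing]
  rw [gradPairing_tensor hφ, gradPairing_tensor hφ, gradPairing_tensor hφ,
    pi_update_mix γ i hab A B, integral_add_measure, integral_smul_measure, integral_smul_measure]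
  · rfl
  · exact (integrable_pairing hφ hφc _ fun j => (hup hA j).cost_lt_top).smul_measure ha
  · exact (integrable_pairing hφ hφc _ fun j => (hup hB j).cost_lt_top).smul_measure hb

/-- The pairings of `∇φ` with the elements of `𝒱[μ]`. -/
def pairings (lam : P2 (Space d) → ℝ) (φ : Ensemble d N → ℝ) (μ : P2 (Ensemble d N)) : Set ℝ :=
  gradPairing φ '' field lam μ

lemma planPairing_mem_pairings {lam : P2 (Space d) → ℝ} (φ : Ensemble d N → ℝ)
    {μ : P2 (Ensemble d N)} {γ : Fin N → Measure (Space d × Space d)}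
    (hγ : ∀ i, IsBarPlan lam μ i (γ i)) : planPairing φ γ ∈ pairings lam φ μ :=
  ⟨_, ⟨γ, hγ, rfl⟩, rfl⟩

lemma uIcc_planPairing_update_subset {φ : Ensemble d N → ℝ} (hφ : ContDiff ℝ ∞ φ)
    (hφc : HasCompactSupport φ) {lam : P2 (Space d) → ℝ} (hpos : ∀ m, 0 < lam m)
    {μ : P2 (Ensemble d N)} {γ : Fin N → Measure (Space d × Space d)}
    (hγ : ∀ i, IsBarPlan lam μ i (γ i)) {i : Fin N} {A : Measure (Space d × Space d)}
    (hA : IsBarPlan lam μ i A) :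
    uIcc (planPairing φ γ) (planPairing φ (Function.update γ i A)) ⊆ pairings lam φ μ := by
  intro x hx
  rw [← segment_eq_uIcc] at hx
  obtain ⟨a, b, ha, hb, hab, rfl⟩ := hx
  have hab' : ENNReal.ofReal a + ENNReal.ofReal b = 1 := by
    rw [← ENNReal.ofReal_add ha hb, hab, ENNReal.ofReal_one]
  have h := planPairing_update_mix hφ hφc hpos hγ (hγ i) hA hab'
  rw [Function.update_eq_self, ENNReal.toReal_ofReal ha, ENNReal.toReal_ofReal hb] at h
  rw [smul_eq_mul, smul_eq_mul, ← h]
  refine planPairing_mem_pairings φ fun j => ?_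
  rcases eq_or_ne j i with rfl | hj
  · simpa using (hγ j).mix hpos hab' hA
  · simpa [hj] using hγ j

/-- The possible values of `⟨∇φ, W⟩` form an interval: replacing the plan of one agent at a time,
the pairing moves along segments. -/
lemma ordConnected_pairings {φ : Ensemble d N → ℝ} (hφ : ContDiff ℝ ∞ φ)
    (hφc : HasCompactSupport φ) {lam : P2 (Space d) → ℝ} (hpos : ∀ m, 0 < lam m)
    (μ : P2 (Ensemble d N)) : (pairings lam φ μ).OrdConnected := by
  rw [ordConnected_iff_uIcc_subset]
  rintro _ ⟨_, ⟨γ, hγ, rfl⟩, rfl⟩ _ ⟨_, ⟨γ', hγ', rfl⟩, rfl⟩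
  have key (s : Finset (Fin N)) :
      uIcc (planPairing φ γ) (planPairing φ (s.piecewise γ' γ)) ⊆ pairings lam φ μ := by
    induction s using Finset.induction_on with
    | empty => simpa using planPairing_mem_pairings φ hγ
    | insert j s _ ih =>
      rw [Finset.piecewise_insert]
      refine uIcc_subset_uIcc_union_uIcc.trans (union_subset ih
        (uIcc_planPairing_update_subset hφ hφc hpos (fun i => ?_) (hγ' j)))
      by_cases hi : i ∈ s
      · simpa [hi] using (show IsBarPlan lam μ i (γ' i) from hγ' i)
      · simpa [hi] using (show IsBarPlan lam μ i (γ i) from hγ i)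
  simpa [planPairing] using key Finset.univ

/-! ### Scalar differential inclusions -/

lemma mul_sub_le_of_le_deriv {f : ℝ → ℝ} {a b c : ℝ} (hab : a ≤ b)
    (hf : AbsolutelyContinuousOnInterval f a b) (h : ∀ᵐ t, t ∈ Icc a b → c ≤ deriv f t) :
    c * (b - a) ≤ f b - f a := by
  rw [← hf.integral_deriv_eq_sub]
  calc c * (b - a) = ∫ _ in a..b, c := by simp [mul_comm]
    _ ≤ _ := by
      refine intervalIntegral.integral_mono_ae_restrict hab intervalIntegrable_const
        hf.intervalIntegrable_deriv ?_
      exact (ae_restrict_iff' measurableSet_Icc).2 h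

/-- `f` solves the scalar differential inclusion `f' ∈ S` on `[0, T]`. -/
def SolvesInclusion (T : ℝ) (S : ℝ → Set ℝ) (f : ℝ → ℝ) : Prop :=
  AbsolutelyContinuousOnInterval f 0 T ∧ ∀ᵐ t ∂(volume.restrict (Icc 0 T)),
    ∃ y ∈ S t, HasDerivWithinAt f y (Icc 0 T) t

/-- The sets `S n` converge to `S₀` in the sense of upper semicontinuity with compact values. -/
def SubseqClosed (T : ℝ) (S : ℕ → ℝ → Set ℝ) (S₀ : ℝ → Set ℝ) : Prop :=
  ∀ (n : ℕ → ℕ) (s : ℕ → ℝ) (t : ℝ) (y : ℕ → ℝ), Tendsto n atTop atTop →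
    (∀ k, s k ∈ Icc 0 T) → t ∈ Icc 0 T → Tendsto s atTop (𝓝 t) → (∀ k, y k ∈ S (n k) (s k)) →
    ∃ y₀ ∈ S₀ t, ∃ ψ : ℕ → ℕ, StrictMono ψ ∧ Tendsto (fun k => y (ψ k)) atTop (𝓝 y₀)

variable {T : ℝ}

lemma SolvesInclusion.neg {S : ℝ → Set ℝ} {f : ℝ → ℝ} (h : SolvesInclusion T S f) :
    SolvesInclusion T (fun t => -S t) (-f) := by
  refine ⟨h.1.neg, ?_⟩
  filter_upwards [h.2] with t ⟨y, hy, hd⟩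
  exact ⟨-y, by simpa using hy, hd.neg⟩

lemma SolvesInclusion.mul_sub_le {S : ℝ → Set ℝ} {f : ℝ → ℝ} (h : SolvesInclusion T S f)
    {a b c : ℝ} (ha : a ∈ Icc 0 T) (hb : b ∈ Icc 0 T) (hab : a ≤ b)
    (hc : ∀ t ∈ Icc a b, ∀ y ∈ S t, c ≤ y) : c * (b - a) ≤ f b - f a := by
  have hT : 0 ≤ T := ha.1.trans ha.2
  have hsub : Icc a b ⊆ Icc 0 T := Icc_subset_Icc ha.1 hb.2
  refine mul_sub_le_of_le_deriv hab (h.1.mono ?_) ?_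
  · rwa [uIcc_of_le hab, uIcc_of_le hT]
  have h2 := (ae_restrict_iff' measurableSet_Icc).1 h.2
  -- Away from the endpoints the derivative within `Icc 0 T` is the ordinary derivative.
  have hn0 : ∀ᵐ t : ℝ, t ≠ 0 := by simp [ae_iff]
  have hnT : ∀ᵐ t : ℝ, t ≠ T := by simp [ae_iff]
  filter_upwards [h2, hn0, hnT] with t ht h0 hT ht'
  obtain ⟨y, hy, hd⟩ := ht (hsub ht')
  have hmem := hsub ht'
  rw [(hd.hasDerivAt (Icc_mem_nhds (lt_of_le_of_ne hmem.1 h0.symm)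
    (lt_of_le_of_ne hmem.2 hT))).deriv]
  exact hc t ht' y hy

lemma SubseqClosed.neg {S : ℕ → ℝ → Set ℝ} {S₀ : ℝ → Set ℝ} (h : SubseqClosed T S S₀) :
    SubseqClosed T (fun n t => -S n t) (fun t => -S₀ t) := by
  intro n s t y hn hs ht hst hy
  obtain ⟨y₀, hy₀, ψ, hψ, hlim⟩ := h n s t (fun k => -y k) hn hs ht hst hy
  exact ⟨-y₀, by simpa using hy₀, ψ, hψ, by simpa using hlim.neg⟩

/-- Otherwise some selection with `|y k| > k` at indices tending to infinity would have a convergent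
subsequence. -/
lemma SubseqClosed.exists_bound {S : ℕ → ℝ → Set ℝ} {S₀ : ℝ → Set ℝ} (h : SubseqClosed T S S₀) :
    ∃ C : ℝ, ∃ n₀ : ℕ, ∀ n ≥ n₀, ∀ t ∈ Icc 0 T, ∀ y ∈ S n t, |y| ≤ C := by
  by_contra! hcon
  choose n hn s hs y hy hlt using fun k : ℕ => hcon k k
  obtain ⟨t, ht, χ, hχ, hlim⟩ := isCompact_Icc.tendsto_subseq hs
  obtain ⟨y₀, -, ψ, hψ, hlim'⟩ := h (n ∘ χ) (s ∘ χ) t (y ∘ χ)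
    ((tendsto_atTop_mono hn tendsto_id).comp hχ.tendsto_atTop) (fun k => hs _) ht hlim
    (fun k => hy _)
  refine not_tendsto_nhds_of_tendsto_atTop ?_ _ hlim'.abs
  exact tendsto_atTop_mono (fun k => (hlt (χ (ψ k))).le)
    (tendsto_natCast_atTop_atTop.comp (hχ.comp hψ).tendsto_atTop)

lemma SubseqClosed.exists_le_of_hasDerivAt {S : ℕ → ℝ → Set ℝ} {S₀ : ℝ → Set ℝ}
    (h : SubseqClosed T S S₀) {f : ℕ → ℝ → ℝ} {f₀ : ℝ → ℝ}
    (hf : ∀ n, SolvesInclusion T (S n) (f n))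
    (hlim : ∀ t ∈ Icc 0 T, Tendsto (fun n => f n t) atTop (𝓝 (f₀ t))) {t D : ℝ}
    (ht : t ∈ Ioo 0 T) (hD : HasDerivAt f₀ D t) : ∃ y ∈ S₀ t, y ≤ D := by
  by_contra! hcon
  have htI : t ∈ Icc 0 T := Ioo_subset_Icc_self ht
  -- A single `k` serves as index threshold, time radius and gap; if none worked, a limit of
  -- violating values would be an element of `S₀ t` that is at most `D`.
  obtain ⟨k, hk⟩ : ∃ k : ℕ, ∀ n ≥ k, ∀ s ∈ Icc 0 T, |s - t| ≤ 1 / ((k : ℝ) + 1) →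
      ∀ y ∈ S n s, D + 1 / ((k : ℝ) + 1) ≤ y := by
    by_contra! hcon'
    choose n hn s hs hst y hy hlt using hcon'
    have hst' : Tendsto s atTop (𝓝 t) := by
      rw [tendsto_iff_dist_tendsto_zero]
      exact squeeze_zero (fun _ => dist_nonneg) (fun k => hst k)
        tendsto_one_div_add_atTop_nhds_zero_nat
    obtain ⟨y₀, hy₀, ψ, hψ, hlim'⟩ := h n s t y (tendsto_atTop_mono hn tendsto_id) hs htI hst' hy
    refine absurd (hcon y₀ hy₀) (not_lt.2 ?_)
    refine le_of_tendsto_of_tendsto' hlim' ?_ fun k => (hlt (ψ k)).le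
    simpa using! (tendsto_const_nhds (x := D)).add
      (tendsto_one_div_add_atTop_nhds_zero_nat (𝕜 := ℝ).comp hψ.tendsto_atTop)
  have hε : (0 : ℝ) < 1 / ((k : ℝ) + 1) := by positivity
  set ε := 1 / ((k : ℝ) + 1)
  have hslope : Tendsto (slope f₀ t) (𝓝[>] t) (𝓝 D) :=
    (hasDerivWithinAt_iff_tendsto_slope' self_notMem_Ioi).1 hD.hasDerivWithinAt
  refine absurd (ge_of_tendsto hslope (b := D + ε) ?_) (by linarith)
  have hev : ∀ᶠ b in 𝓝[>] t, b ∈ Ioo t (min T (t + ε)) :=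
    Ioo_mem_nhdsGT (lt_min ht.2 (by linarith))
  filter_upwards [hev] with b hb
  have hbT : b < T := hb.2.trans_le (min_le_left _ _)
  have hbε : b < t + ε := hb.2.trans_le (min_le_right _ _)
  have hbI : b ∈ Icc 0 T := ⟨htI.1.trans hb.1.le, hbT.le⟩
  rw [slope_def_field, le_div_iff₀ (by linarith [hb.1])]
  refine ge_of_tendsto ((hlim b hbI).sub (hlim t htI)) ?_
  filter_upwards [eventually_ge_atTop k] with n hn
  refine (hf n).mul_sub_le htI hbI hb.1.le fun s hs y hy =>
    hk n hn s ⟨htI.1.trans hs.1, hs.2.trans hbI.2⟩ ?_ y hy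
  rw [abs_of_nonneg (by linarith [hs.1])]
  linarith [hs.2]

/-- Stability of scalar differential inclusions with interval values. -/
lemma SolvesInclusion.of_tendsto {S : ℕ → ℝ → Set ℝ} {S₀ : ℝ → Set ℝ} (hT : 0 ≤ T)
    (h : SubseqClosed T S S₀) (hS : ∀ t ∈ Icc 0 T, (S₀ t).OrdConnected) {f : ℕ → ℝ → ℝ}
    {f₀ : ℝ → ℝ} (hf : ∀ n, SolvesInclusion T (S n) (f n))
    (hlim : ∀ t ∈ Icc 0 T, Tendsto (fun n => f n t) atTop (𝓝 (f₀ t))) :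
    SolvesInclusion T S₀ f₀ := by
  have hlim' : ∀ t ∈ Icc 0 T, Tendsto (fun n => (-f n) t) atTop (𝓝 ((-f₀) t)) :=
    fun t ht => (hlim t ht).neg
  obtain ⟨C, n₀, hC⟩ := h.exists_bound
  have hlip : LipschitzOnWith C.toNNReal f₀ (uIcc 0 T) := by
    rw [uIcc_of_le hT]
    have key {a b : ℝ} (ha : a ∈ Icc 0 T) (hb : b ∈ Icc 0 T) (hab : a ≤ b) :
        |f₀ b - f₀ a| ≤ C * (b - a) := by
      refine le_of_tendsto ((hlim b hb).sub (hlim a ha)).abs ?_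
      filter_upwards [eventually_ge_atTop n₀] with n hn
      have hsub : Icc a b ⊆ Icc 0 T := Icc_subset_Icc ha.1 hb.2
      have h1 := (hf n).mul_sub_le (c := -C) ha hb hab fun t ht y hy =>
        (abs_le.1 (hC n hn t (hsub ht) y hy)).1
      have h2 := (hf n).neg.mul_sub_le (c := -C) ha hb hab fun t ht y hy => by
        have := (abs_le.1 (hC n hn t (hsub ht) (-y) hy)).2
        linarith
      simp only [Pi.neg_apply] at h2
      rw [abs_le]
      constructor <;> linarith
    refine LipschitzOnWith.of_dist_le_mul fun x hx y hy => ?_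
    have hmain : dist (f₀ x) (f₀ y) ≤ C * dist x y := by
      rcases le_total x y with hxy | hxy
      · rw [dist_comm, dist_comm x, Real.dist_eq, Real.dist_eq, abs_of_nonneg (sub_nonneg.2 hxy)]
        exact key hx hy hxy
      · rw [Real.dist_eq, Real.dist_eq, abs_of_nonneg (sub_nonneg.2 hxy)]
        exact key hy hx hxy
    exact hmain.trans (by gcongr; exact Real.le_coe_toNNReal C)
  have hac := hlip.absolutelyContinuousOnInterval
  refine ⟨hac, (ae_restrict_iff' measurableSet_Icc).2 ?_⟩
  have hn0 : ∀ᵐ t : ℝ, t ≠ 0 := by simp [ae_iff]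
  have hnT : ∀ᵐ t : ℝ, t ≠ T := by simp [ae_iff]
  filter_upwards [hac.ae_differentiableAt, hn0, hnT] with t hd h0 hT' ht
  have hD := (hd (by rwa [uIcc_of_le hT])).hasDerivAt
  have htI : t ∈ Ioo 0 T := ⟨lt_of_le_of_ne ht.1 h0.symm, lt_of_le_of_ne ht.2 hT'⟩
  obtain ⟨y₁, hy₁, hle₁⟩ := h.exists_le_of_hasDerivAt hf hlim htI hD
  -- Negating the inclusion supplies an element of `S₀ t` that is at least the derivative.
  obtain ⟨y₂, hy₂, hle₂⟩ := h.neg.exists_le_of_hasDerivAt (fun n => (hf n).neg) hlim' htI hD.neg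
  exact ⟨_, (hS t ht).out hy₁ hy₂ ⟨hle₁, by linarith⟩, hD.hasDerivWithinAt⟩

end ConsensusMDI

/-! ### The closure theorem -/

open ConsensusMDI in
theorem theorem3p6 (d N : ℕ) (T : ℝ) (hT : 0 < T)
    (lam : ConsensusMDI.P2 (ConsensusMDI.Space d) → ℝ)
    (hlam_cont : ConsensusMDI.W2Continuous lam)
    (hlam_pos : ∀ m, 0 < lam m)
    (hlam_bdd : ∃ C : ℝ, ∀ m, lam m ≤ C)
    (u : ℕ → ℝ → ConsensusMDI.P2 (ConsensusMDI.Ensemble d N))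
    (μ : ℝ → ConsensusMDI.P2 (ConsensusMDI.Ensemble d N))
    (hu : ∀ n, u n ∈ ConsensusMDI.Sol lam T)
    (hconv : Tendsto (fun n => ⨆ t ∈ Icc (0 : ℝ) T, ConsensusMDI.W2 (u n t) (μ t))
      atTop (𝓝 0)) :
    μ ∈ ConsensusMDI.Sol lam T ∧
      ∀ L : NNReal, (∀ n, ConsensusMDI.W2LipschitzOn L T (u n)) →
        ConsensusMDI.W2LipschitzOn L T μ := by
  have hle (n : ℕ) (t : ℝ) (ht : t ∈ Icc 0 T) :
      W2 (u n t) (μ t) ≤ ⨆ t ∈ Icc (0 : ℝ) T, W2 (u n t) (μ t) :=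
    le_iSup₂ (f := fun t (_ : t ∈ Icc (0 : ℝ) T) => W2 (u n t) (μ t)) t ht
  have hpt (t : ℝ) (ht : t ∈ Icc 0 T) : Tendsto (fun n => W2 (u n t) (μ t)) atTop (𝓝 0) :=
    tendsto_of_tendsto_of_tendsto_of_le_of_le tendsto_const_nhds hconv (fun _ => zero_le)
      fun n => hle n t ht
  have htri (n : ℕ) (s t : ℝ) :
      W2 (μ s) (μ t) ≤ W2 (u n s) (μ s) + W2 (u n s) (u n t) + W2 (u n t) (μ t) := by
    refine (W2_triangle _ (u n t) _).trans ?_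
    gcongr
    rw [W2_comm (u n s) (μ s)]
    exact W2_triangle _ _ _
  have hcontμ : W2ContinuousOn T μ := by
    intro s hs
    rw [ENNReal.tendsto_nhds_zero]
    intro ε hε
    have h3 : 0 < ε / 3 := ENNReal.div_pos hε.ne' (by simp)
    obtain ⟨n, hn⟩ := (ENNReal.tendsto_nhds_zero.1 hconv _ h3).exists
    filter_upwards [ENNReal.tendsto_nhds_zero.1 ((hu n).1 s hs) _ h3, self_mem_nhdsWithin]
      with t ht htI
    calc _ ≤ _ := htri n t s
      _ ≤ ε / 3 + ε / 3 + ε / 3 := by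
        gcongr
        · exact (hle n t htI).trans hn
        · exact (hle n s hs).trans hn
      _ = ε := ENNReal.add_thirds ε
  refine ⟨⟨hcontμ, fun φ hφ hφc => ?_⟩, fun L hL s hs t ht => ?_⟩
  · have hsol := SolvesInclusion.of_tendsto hT.le (S := fun n t => pairings lam φ (u n t))
      (S₀ := fun t => pairings lam φ (μ t)) (f := fun n t => ∫ x, φ x ∂(u n t).toMeasure)
      (f₀ := fun t => ∫ x, φ x ∂(μ t).toMeasure) ?_
      (fun t _ => ordConnected_pairings hφ hφc hlam_pos (μ t)) (fun n => ?_) fun t ht => ?_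
    · refine ⟨hsol.1, ?_⟩
      filter_upwards [hsol.2] with t ⟨_, ⟨W, hW, rfl⟩, hd⟩
      exact ⟨W, hW, hd⟩
    · intro n s t y hn hs ht hst hy
      choose W hW hWy using hy
      -- Index and time vary together: uniform convergence handles the first, continuity of `μ` the
      -- second.
      have hconv' : Tendsto (fun k => W2 (u (n k) (s k)) (μ t)) atTop (𝓝 0) := by
        have h1 := hconv.comp hn
        have h2 := (hcontμ t ht).comp
          (tendsto_nhdsWithin_iff.2 ⟨hst, Eventually.of_forall hs⟩)
        refine tendsto_of_tendsto_of_tendsto_of_le_of_le tendsto_const_nhds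
          (by simpa using h1.add h2) (fun _ => zero_le) fun k => ?_
        exact (W2_triangle _ (μ (s k)) _).trans (add_le_add (hle _ _ (hs k)) le_rfl)
      obtain ⟨W₀, hW₀, ψ, hψ, hlim⟩ :=
        exists_subseq_gradPairing hlam_cont hlam_pos hφ hφc hconv' hW
      exact ⟨_, ⟨W₀, hW₀, rfl⟩, ψ, hψ, by simpa only [hWy] using hlim⟩
    · refine ⟨((hu n).2 φ hφ hφc).1, ?_⟩
      filter_upwards [((hu n).2 φ hφ hφc).2] with t ⟨W, hW, hd⟩
      exact ⟨_, ⟨W, hW, rfl⟩, hd⟩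
    · have h := ProbabilityMeasure.tendsto_iff_forall_integral_tendsto.1 (tendsto_toProb (hpt t ht))
      obtain ⟨C, hC⟩ := hφ.continuous.bounded_above_of_compact_support hφc
      exact h (BoundedContinuousFunction.ofNormedAddCommGroup φ hφ.continuous C hC)
  · have hlim := ((hpt s hs).add (tendsto_const_nhds (x := (L : ℝ≥0∞) * edist s t))).add (hpt t ht)
    rw [zero_add, add_zero] at hlim
    refine ge_of_tendsto' hlim fun n => (htri n s t).trans ?_
    gcongr
    exact hL n s hs t ht
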